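/- **Proposition 5.** Let $(X,d)$ be a compact metric space, $x_0\in X$, and let $P(X)$ be the set of Borel probability measures on $X$. Let $\mathrm{Lip}(X)$ be the set of Lipschitz functions $f:X\to\mathbb R$, $\|f\|_L=\sup_{x\ne y}|f(x)-f(y)|/d(x,y)$ (with $\sup\emptyset=0$), and $\mathrm{Lip}(X,x_0)=\{f\in\mathrm{Lip}(X): f(x_0)=0\}$. Let $W_1(\mu,\xi)=\inf_\pi\int d\,d\pi$ be the Wasserstein-1 distance, the infimum being over all couplings $\pi$ of $\mu$ and $\xi$. Let $\phi:\mathbb R\to\mathbb R\cup\{+\infty\}$ be proper, convex and lower semicontinuous, strictly convex at $1$, with $\phi(1)=0$ and $1$ in the relative interior of $\operatorname{dom}\phi=\{\phi<\infty\}$; here strict convexity at $1$ means that $t\phi(x_1)+(1-t)\phi(x_2)>\phi(1)$ whenever $t\in(0,1)$, $x_1,x_2\in\operatorname{dom}\phi$ and $tx_1+(1-t)x_2=1$, unless $x_1=x_2=1$. For $\xi,\nu\in P(X)$ with Lebesgue decomposition $\xi=\xi_c+\xi_s$, $\xi_c\ll\nu$, $\xi_s\perp\nu$, put $$D_\phi(\xi\Vert\nu)=\int\phi\Big(\frac{d\xi_c}{d\nu}\Big)d\nu+\phi'(\infty)\,\xi_s(X),\qquad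 \phi'(\infty)=\lim_{x\to\infty}\frac{\phi(x)}{x}$$ (with $\infty\cdot 0=0$), and $D_\phi^*(f\Vert\nu)=\sup_{\xi\in P(X)}\{\int f\,d\xi-D_\phi(\xi\Vert\nu)\}$ for $f\in\mathrm{Lip}(X)$. A function $f\in\mathrm{Lip}(X)$ is a *Csiszár potential* of $(\xi,\nu)$ if $D_\phi(\xi\Vert\nu)=\int f\,d\xi-D_\phi^*(f\Vert\nu)$, and a *Kantorovich potential* of $(\mu,\xi)$ if $\|f\|_L\le1$ and $W_1(\mu,\xi)=\int f\,d\mu-\int f\,d\xi$. Let $\mu,\nu\in P(X)$, $\lambda>0$, $\alpha\ge1$, and let $\xi_*\in P(X)$ attain the minimum in $$D_{\phi,\lambda,\alpha}(\mu\Vert\nu)=\min_{\xi\in P(X)}\{D_\phi(\xi\Vert\nu)+\lambda W_1(\mu,\xi)^\alpha\}.$$ Then there is $f_*\in\mathrm{Lip}(X,x_0)$ that attains the maximum in the dual formula $$D_{\phi,\lambda,1}(\mu\Vert\nu)=\max_{f\in\mathrm{Lip}(X,x_0),\ \|f\|_L\le\lambda}\Big\{\int f\,d\mu-D_\phi^*(f\Vert\nu)\Big\}$$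 if $\alpha=1$, respectively $$D_{\phi,\lambda,\alpha}(\mu\Vert\nu)=\max_{f\in\mathrm{Lip}(X,x_0)}\Big\{\int f\,d\mu-D_\phi^*(f\Vert\nu)-(\alpha-1)\alpha^{\frac{\alpha}{1-\alpha}}\lambda^{\frac1{1-\alpha}}\|f\|_L^{\frac{\alpha}{\alpha-1}}\Big\}$$ if $\alpha>1$, and that is at the same time a Csiszár potential of $(\xi_*,\nu)$ and $\alpha\lambda W_1(\mu,\xi_*)^{\alpha-1}$ times a Kantorovich potential of $(\mu,\xi_*)$ (where $0^0=1$). Moreover, if $\alpha>1$ or $\xi_*\neq\mu$, then $\|f_*\|_L=\alpha\lambda W_1(\mu,\xi_*)^{\alpha-1}$. -/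

import Mathlib

open MeasureTheory Filter Topology
open scoped ENNReal NNReal

namespace MoreauYosida

noncomputable section

/-! ### Extended-real convex functions on the line -/

/-- The effective domain of an extended-real-valued function. -/
def effDom (φ : ℝ → EReal) : Set ℝ := {x | φ x < ⊤}

/-- `φ` is proper: its effective domain is nonempty and it never takes the value `-∞`. -/
def IsProper (φ : ℝ → EReal) : Prop := (effDom φ).Nonempty ∧ ∀ x, φ x ≠ ⊥

/-- Convexity of an extended-real-valued function. -/
def IsConvex (φ : ℝ → EReal) : Prop :=
  ∀ x y t : ℝ, 0 ≤ t → t ≤ 1 →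
    φ (t * x + (1 - t) * y) ≤ (t : EReal) * φ x + ((1 - t : ℝ) : EReal) * φ y

/-- `φ` is strictly convex at the point `x₀`. -/
def IsStrictlyConvexAt (φ : ℝ → EReal) (x₀ : ℝ) : Prop :=
  ∀ x₁ ∈ effDom φ, ∀ x₂ ∈ effDom φ, ∀ t : ℝ, 0 < t → t < 1 →
    t * x₁ + (1 - t) * x₂ = x₀ → ¬ (x₁ = x₀ ∧ x₂ = x₀) →
    φ x₀ < (t : EReal) * φ x₁ + ((1 - t : ℝ) : EReal) * φ x₂

/-- The standing assumptions on the function generating the divergence: proper, convex, lower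
semicontinuous, strictly convex at `1`, `φ 1 = 0`, and `1` lies in the relative interior of the
effective domain. -/
structure IsDivergenceFunction (φ : ℝ → EReal) : Prop where
  proper : IsProper φ
  convex : IsConvex φ
  lsc : LowerSemicontinuous φ
  strictlyConvexAt_one : IsStrictlyConvexAt φ 1
  map_one : φ 1 = 0
  one_mem_relint : (1 : ℝ) ∈ intrinsicInterior ℝ (effDom φ)

/-- The recession slope `φ'(∞) = lim_{x → ∞} φ x / x`. For the functions `φ` considered here this
limit exists in the extended reals, and then it is equal to the upper limit. -/
def slopeAtTop (φ : ℝ → EReal) : EReal := limsup (fun x : ℝ => φ x / (x : EReal)) atTop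

/-! ### Divergences -/

variable {X : Type*} [MeasurableSpace X]

/-- The integral of an extended-real-valued function, `∫ g⁺ - ∫ g⁻`. -/
def integralEReal (g : X → EReal) (ν : Measure X) : EReal :=
  ((∫⁻ x, (g x).toENNReal ∂ν : ℝ≥0∞) : EReal) - ((∫⁻ x, (-g x).toENNReal ∂ν : ℝ≥0∞) : EReal)

/-- The divergence `D_φ(ξ ‖ ν)` of probability measures,
`∫ φ(dξ_c/dν) dν + φ'(∞) ξ_s(X)`, where `ξ = ξ_c + ξ_s` is the Lebesgue decomposition with respect
to `ν` (the singular part is nonnegative, so its negative part does not contribute). -/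
def divergence (φ : ℝ → EReal) (ξ ν : ProbabilityMeasure X) : EReal :=
  integralEReal (fun x => φ (((ξ : Measure X).rnDeriv ν x).toReal)) (ν : Measure X)
    + slopeAtTop φ * (((ξ : Measure X).singularPart ν Set.univ : ℝ≥0∞) : EReal)

/-- The tight convex conjugate
`D_φ^*(f ‖ ν) = sup_{ξ ∈ P(X)} (∫ f dξ - D_φ(ξ ‖ ν))`. -/
def tightConjugate (φ : ℝ → EReal) (ν : ProbabilityMeasure X) (f : X → ℝ) : EReal :=
  ⨆ ξ : ProbabilityMeasure X, ((∫ x, f x ∂(ξ : Measure X) : ℝ) : EReal) - divergence φ ξ ν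

/-! ### Lipschitz functions and the Wasserstein distance -/

variable [MetricSpace X]

/-- `f` is Lipschitz continuous (with some constant). -/
def IsLip (f : X → ℝ) : Prop := ∃ K : ℝ≥0, LipschitzWith K f

/-- The Lipschitz norm `‖f‖_L = sup_{x ≠ y} |f x - f y| / d(x, y)` of a Lipschitz function
(equal to `0` when `X` has only one point). -/
def lipNorm (f : X → ℝ) : ℝ :=
  sSup {r : ℝ | ∃ x y : X, x ≠ y ∧ r = |f x - f y| / dist x y}

/-- `π` is a coupling of `μ` and `ν`. -/
def IsCoupling (μ ν : ProbabilityMeasure X) (π : ProbabilityMeasure (X × X)) : Prop :=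
  (π : Measure (X × X)).map Prod.fst = (μ : Measure X) ∧
    (π : Measure (X × X)).map Prod.snd = (ν : Measure X)

/-- The Wasserstein-1 distance
`W₁(μ, ν) = inf_π ∫ d(x₁, x₂) dπ(x₁, x₂)` over all couplings `π` of `μ` and `ν`. -/
def W1 (μ ν : ProbabilityMeasure X) : ℝ :=
  sInf {r : ℝ | ∃ π : ProbabilityMeasure (X × X), IsCoupling μ ν π ∧
    r = ∫ p, dist p.1 p.2 ∂(π : Measure (X × X))}

/-- `f` is a Csiszár potential of `(ξ, ν)`: a Lipschitz function with
`D_φ(ξ ‖ ν) = ∫ f dξ - D_φ^*(f ‖ ν)`. -/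
def IsCsiszarPotential (φ : ℝ → EReal) (ξ ν : ProbabilityMeasure X) (f : X → ℝ) : Prop :=
  IsLip f ∧
    divergence φ ξ ν = ((∫ x, f x ∂(ξ : Measure X) : ℝ) : EReal) - tightConjugate φ ν f

/-- `f` is a Kantorovich potential of `(μ, ξ)`: `‖f‖_L ≤ 1` and
`W₁(μ, ξ) = ∫ f dμ - ∫ f dξ`. -/
def IsKantorovichPotential (μ ξ : ProbabilityMeasure X) (f : X → ℝ) : Prop :=
  IsLip f ∧ lipNorm f ≤ 1 ∧
    W1 μ ξ = ∫ x, f x ∂(μ : Measure X) - ∫ x, f x ∂(ξ : Measure X)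

/-! ### Moreau–Yosida approximation -/

/-- The objective `ξ ↦ D_φ(ξ ‖ ν) + lam * W₁(μ, ξ) ^ α` of the primal problem. -/
def primalObjective (φ : ℝ → EReal) (lam α : ℝ) (μ ν ξ : ProbabilityMeasure X) : EReal :=
  divergence φ ξ ν + ((lam * W1 μ ξ ^ α : ℝ) : EReal)

/-- The Moreau–Yosida approximation `D_{φ,lam,α}(μ ‖ ν)` of index `lam` and order `α`. -/
def moreauYosida (φ : ℝ → EReal) (lam α : ℝ) (μ ν : ProbabilityMeasure X) : EReal :=
  ⨅ ξ : ProbabilityMeasure X, primalObjective φ lam α μ ν ξ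

/-- The space `Lip(X, x₀)` of Lipschitz functions vanishing at `x₀`. -/
def LipAt (x₀ : X) : Set (X → ℝ) := {f | IsLip f ∧ f x₀ = 0}

/-- The admissible functions in the dual problem of order `α`: those in `Lip(X, x₀)`, with the
constraint `‖f‖_L ≤ lam` if `α = 1`. -/
def dualFeasible (lam α : ℝ) (x₀ : X) : Set (X → ℝ) :=
  {f | f ∈ LipAt x₀ ∧ (α = 1 → lipNorm f ≤ lam)}

open Classical in
/-- The objective of the dual problem of order `α ≥ 1`: `∫ f dμ - D_φ^*(f ‖ ν)` if `α = 1`, and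
`∫ f dμ - D_φ^*(f ‖ ν) - (α-1) α^{α/(1-α)} lam^{1/(1-α)} ‖f‖_L^{α/(α-1)}` if `α > 1`. -/
def dualObjective (φ : ℝ → EReal) (lam α : ℝ) (μ ν : ProbabilityMeasure X) (f : X → ℝ) : EReal :=
  if α = 1 then
    ((∫ x, f x ∂(μ : Measure X) : ℝ) : EReal) - tightConjugate φ ν f
  else
    ((∫ x, f x ∂(μ : Measure X) : ℝ) : EReal) - tightConjugate φ ν f
      - (((α - 1) * α ^ (α / (1 - α)) * lam ^ (1 / (1 - α))
          * lipNorm f ^ (α / (α - 1)) : ℝ) : EReal)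

end

end MoreauYosida

namespace MoreauYosida

noncomputable section

/-! ### A minimax theorem -/

section Minimax

variable {E ι : Type*} [AddCommGroup E] [Module ℝ E] [TopologicalSpace E]

/-! Put `w = W1 μ ξ` and let `c = α * lam * w ^ (α - 1)` be the derivative of the penalty there.
Both the divergence and `W1 μ` are convex along mixtures, so first-order optimality on segments
shows that `ξ` also minimizes the linearized objective `D + c * W1 μ` (`linearized_objective_le`).
By Kantorovich–Rubinstein duality, proved here by Hahn–Banach and Riesz, `c * W1 μ η` is the maximum
of `∫ f dμ - ∫ f dη` over `c`-Lipschitz `f` with `f x₀ = 0`. These form a compact convex set, so a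
minimax argument gives one `f` with `D ξ + c * w ≤ D η + ∫ f dμ - ∫ f dη` for every `η` of finite
divergence (`exists_mem_lipBall_forall_le`).

Everything is read off from this inequality. At `η = ξ` it forces `∫ f dμ - ∫ f dξ = c * w`, so `f`
is `c` times a Kantorovich potential; substituting this back, `ξ` maximizes `∫ f dη - D η`, so `f`
is a Csiszár potential. Weak duality is Young's inequality, with equality at slope `c`.

Subtracting an affine minorant `s * (x - 1)` from `φ` turns the divergence into an `ℝ≥0∞`-valued
functional, which makes its convexity accessible (`IsDivergenceFunction.divergence_eq`). -/

theorem nonneg_of_forall_lt_mul_add {r s b : ℝ} (h : ∀ a : ℝ, 0 < a → s < a * r + b) :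
    0 ≤ r := by
  by_contra! hr
  have h1 := h ((|s - b| + 1) / (-r)) (div_pos (by positivity) (by linarith))
  have h2 : (|s - b| + 1) / (-r) * r = -(|s - b| + 1) := by
    rw [div_mul_eq_mul_div, div_eq_iff (by linarith)]
    ring
  linarith [neg_abs_le (s - b)]

/-- Two concave functions on a compact convex set, all of whose convex combinations reach the
level `m`, reach it simultaneously. -/
theorem exists_le_and_le_of_concaveOn {K : Set E} (hK : IsCompact K) (hne : K.Nonempty)
    {g h : E → ℝ} (hg : ConcaveOn ℝ K g) (hh : ConcaveOn ℝ K h)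
    (hgc : ContinuousOn g K) (hhc : ContinuousOn h K) {m : ℝ}
    (hm : ∀ t : ℝ, 0 ≤ t → t ≤ 1 → ∃ f ∈ K, m ≤ t * g f + (1 - t) * h f) :
    ∃ f ∈ K, m ≤ g f ∧ m ≤ h f := by
  obtain ⟨f₀, hf₀, hmax⟩ := hK.exists_isMaxOn hne (hgc.inf hhc)
  by_contra! hcon
  set m' : ℝ := min (g f₀) (h f₀) with hm'
  have hlt : m' < m := by
    by_contra! hle
    exact absurd (hcon f₀ hf₀ (hle.trans (min_le_left _ _)))
      (not_lt.2 (hle.trans (min_le_right _ _)))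
  have hle : ∀ f ∈ K, min (g f) (h f) ≤ m' := fun f hf => hmax hf
  -- `m'` is the maximum of `min g h`. The region `S` below the image of `(g, h)` is convex by
  -- concavity and misses the open quadrant `T` with corner `(m', m')`. The separating functional
  -- gives weights `p, q ≥ 0`, and normalizing them gives a `t` that contradicts `hm`.
  let S : Set (ℝ × ℝ) := {p | ∃ f ∈ K, p.1 ≤ g f ∧ p.2 ≤ h f}
  let T : Set (ℝ × ℝ) := Set.Ioi m' ×ˢ Set.Ioi m'
  have hT : Convex ℝ T := (convex_Ioi m').prod (convex_Ioi m')
  have hTo : IsOpen T := isOpen_Ioi.prod isOpen_Ioi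
  have hS : Convex ℝ S := by
    rintro p ⟨f, hf, hp1, hp2⟩ q ⟨f', hf', hq1, hq2⟩ a b ha hb hab
    refine ⟨a • f + b • f', hg.1 hf hf' ha hb hab, ?_, ?_⟩
    · refine le_trans ?_ (hg.2 hf hf' ha hb hab)
      simp only [Prod.fst_add, Prod.smul_fst, smul_eq_mul]
      gcongr
    · refine le_trans ?_ (hh.2 hf hf' ha hb hab)
      simp only [Prod.snd_add, Prod.smul_snd, smul_eq_mul]
      gcongr
  have hdisj : Disjoint T S := by
    rw [Set.disjoint_left]
    rintro p ⟨h1, h2⟩ ⟨f, hf, hp1, hp2⟩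
    exact absurd (hle f hf) (not_le.2 (lt_min (lt_of_lt_of_le h1 hp1) (lt_of_lt_of_le h2 hp2)))
  obtain ⟨l, u, hlT, hlS⟩ := geometric_hahn_banach_open hT hTo hS hdisj
  set p : ℝ := - l (1, 0) with hp
  set q : ℝ := - l (0, 1) with hq
  have hl : ∀ a b : ℝ, l (a, b) = -(a * p) - b * q := by
    intro a b
    have : ((a, b) : ℝ × ℝ) = a • (1, 0) + b • (0, 1) := by simp
    rw [this, map_add, map_smul, map_smul, hp, hq]
    simp only [smul_eq_mul]
    ring
  have hS' : ∀ f ∈ K, g f * p + h f * q ≤ -u := by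
    intro f hf
    have := hlS (g f, h f) ⟨f, hf, le_rfl, le_rfl⟩
    rw [hl] at this
    linarith
  have hT' : ∀ a b : ℝ, 0 < a → 0 < b → -u < (m' + a) * p + (m' + b) * q := by
    intro a b ha hb
    have := hlT (m' + a, m' + b) ⟨by simpa using ha, by simpa using hb⟩
    rw [hl] at this
    linarith
  have hpq := hS' f₀ hf₀
  have hp0 : 0 ≤ p := nonneg_of_forall_lt_mul_add (s := -u) (b := m' * p + (m' + 1) * q)
    fun a ha => by linarith [hT' a 1 ha one_pos]
  have hq0 : 0 ≤ q := nonneg_of_forall_lt_mul_add (s := -u) (b := m' * q + (m' + 1) * p)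
    fun a ha => by linarith [hT' 1 a one_pos ha]
  have hlim : -u ≤ m' * (p + q) := by
    refine le_of_forall_pos_lt_add fun ε hε => ?_
    have hd : 0 < ε / (p + q + 1) := by positivity
    refine (hT' _ _ hd hd).trans_le ?_
    have : ε / (p + q + 1) * (p + q) ≤ ε := by
      rw [div_mul_eq_mul_div, div_le_iff₀ (by positivity)]
      nlinarith
    linarith
  have hpos : 0 < p + q := by
    rcases (add_nonneg hp0 hq0).eq_or_lt with h0 | h0
    · have hp' : p = 0 := by linarith
      have hq' : q = 0 := by linarith
      have h1 := hT' 1 1 one_pos one_pos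
      rw [hp', hq'] at h1 hpq
      linarith
    · exact h0
  obtain ⟨f, hf, hfm⟩ := hm (p / (p + q)) (by positivity)
    ((div_le_one hpos).2 (by linarith))
  have h1 : p / (p + q) * g f + (1 - p / (p + q)) * h f = (g f * p + h f * q) / (p + q) := by
    field_simp
    ring
  rw [h1, le_div_iff₀ hpos] at hfm
  have := hS' f hf
  nlinarith

/-- Minimax theorem: a convexlike family of continuous concave functions on a compact convex set,
each of which reaches the level `m`, reaches it at a common point. -/
theorem exists_forall_le_of_concaveOn [T2Space E] {K : Set E} (hK : IsCompact K)
    (hconv : Convex ℝ K) (hne : K.Nonempty) {G : ι → E → ℝ}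
    (hG : ∀ i, ConcaveOn ℝ K (G i)) (hGc : ∀ i, ContinuousOn (G i) K)
    (hmix : ∀ i j, ∀ t : ℝ, 0 ≤ t → t ≤ 1 →
      ∃ k, ∀ f ∈ K, G k f ≤ t * G i f + (1 - t) * G j f)
    {m : ℝ} (hm : ∀ i, ∃ f ∈ K, m ≤ G i f) :
    ∃ f ∈ K, ∀ i, m ≤ G i f := by
  classical
  let C : Finset ι → Set E := fun s => {f | f ∈ K ∧ ∀ i ∈ s, m ≤ G i f}
  -- The last clause keeps the induction going: every `G j` still reaches `m` on the smaller set,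
  -- since mixtures of `G i` and `G j` dominate some `G k`, which reaches `m` on `C s`.
  have hC : ∀ s, IsCompact (C s) ∧ Convex ℝ (C s) ∧ (C s).Nonempty ∧
      ∀ i, ∃ f ∈ C s, m ≤ G i f := by
    intro s
    induction s using Finset.induction_on with
    | empty => simpa [C] using ⟨hK, hconv, hne, hm⟩
    | insert i s _ ih =>
      obtain ⟨h1, h2, h3, h4⟩ := ih
      have hsub : C s ⊆ K := fun f hf => hf.1
      have heq : C (insert i s) = C s ∩ (G i) ⁻¹' Set.Ici m := by
        ext f
        simp only [C, Finset.mem_insert, forall_eq_or_imp, Set.mem_ofPred_eq, Set.mem_inter_iff,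
          Set.mem_preimage, Set.mem_Ici]
        tauto
      have key : ∀ j, ∃ f ∈ C (insert i s), m ≤ G j f := by
        intro j
        obtain ⟨f, hf, hfi, hfj⟩ := exists_le_and_le_of_concaveOn h1 h3
          ((hG i).subset hsub h2) ((hG j).subset hsub h2) ((hGc i).mono hsub)
          ((hGc j).mono hsub) (m := m) (fun t ht0 ht1 => by
            obtain ⟨k, hk⟩ := hmix i j t ht0 ht1
            obtain ⟨f, hf, hfk⟩ := h4 k
            exact ⟨f, hf, hfk.trans (hk f (hsub hf))⟩)
        exact ⟨f, heq ▸ ⟨hf, hfi⟩, hfj⟩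
      refine ⟨?_, ?_, ?_, key⟩
      · rw [heq]
        exact h1.of_isClosed_subset
          (((hGc i).mono hsub).preimage_isClosed_of_isClosed h1.isClosed isClosed_Ici)
          Set.inter_subset_left
      · rw [heq]
        exact ((hG i).subset hsub h2).convex_ge m
      · obtain ⟨f, hf, -⟩ := key i
        exact ⟨f, hf⟩
  have hfin := hK.inter_iInter_nonempty (fun i => K ∩ (G i) ⁻¹' Set.Ici m)
    (fun i => (hGc i).preimage_isClosed_of_isClosed hK.isClosed isClosed_Ici) (fun s => by
      obtain ⟨f, hf⟩ := (hC s).2.2.1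
      exact ⟨f, hf.1, Set.mem_iInter₂.2 fun i hi => ⟨hf.1, hf.2 i hi⟩⟩)
  obtain ⟨f, hf, hfi⟩ := hfin
  exact ⟨f, hf, fun i => (Set.mem_iInter.1 hfi i).2⟩

end Minimax

/-! ### Balls of Lipschitz functions -/

section LipBall

open BoundedContinuousFunction

variable {X : Type*} [MetricSpace X]

/-- The functions with Lipschitz constant `c` that vanish at `x₀`. -/
def lipBall (x₀ : X) (c : ℝ) : Set (X →ᵇ ℝ) :=
  {f | f x₀ = 0 ∧ ∀ x y, |f x - f y| ≤ c * dist x y}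

/-- Arzelà–Ascoli: vanishing at `x₀` bounds the values by `c` times the diameter, and the common
Lipschitz constant gives equicontinuity. -/
theorem isCompact_lipBall [CompactSpace X] (x₀ : X) {c : ℝ} (hc : 0 ≤ c) :
    IsCompact (lipBall x₀ c) := by
  refine arzela_ascoli₂ (Set.Icc (-(c * Metric.diam (Set.univ : Set X)))
    (c * Metric.diam (Set.univ : Set X))) isCompact_Icc _ ?_ ?_ ?_
  · have : lipBall x₀ c = {f : X →ᵇ ℝ | f x₀ = 0} ∩
        ⋂ (x : X) (y : X), {f : X →ᵇ ℝ | |f x - f y| ≤ c * dist x y} := by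
      ext f; simp [lipBall]
    rw [this]
    have hev : ∀ x : X, Continuous fun f : X →ᵇ ℝ => f x := fun x => continuous_eval_const x
    refine (isClosed_eq (hev x₀) continuous_const).inter
      (isClosed_iInter fun x => isClosed_iInter fun y => ?_)
    exact isClosed_le ((hev x).sub (hev y)).abs continuous_const
  · rintro f x ⟨h0, h⟩
    have h1 := h x x₀
    rw [h0, sub_zero] at h1
    have h2 : dist x x₀ ≤ Metric.diam (Set.univ : Set X) :=
      Metric.dist_le_diam_of_mem isCompact_univ.isBounded (Set.mem_univ _) (Set.mem_univ _)
    exact abs_le.1 (h1.trans (by gcongr))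
  · refine LipschitzWith.uniformEquicontinuous (K := c.toNNReal) _ (fun f => ?_) |>.equicontinuous
    refine LipschitzWith.of_dist_le_mul fun x y => ?_
    rw [Real.dist_eq, Real.coe_toNNReal _ hc]
    exact f.2.2 x y

theorem convex_lipBall (x₀ : X) (c : ℝ) : Convex ℝ (lipBall x₀ c) := by
  rintro f ⟨hf0, hf⟩ g ⟨hg0, hg⟩ a b ha hb hab
  refine ⟨by simp [hf0, hg0], fun x y => ?_⟩
  have h1 : (a • f + b • g) x - (a • f + b • g) y = a * (f x - f y) + b * (g x - g y) := by
    simp only [BoundedContinuousFunction.coe_add, BoundedContinuousFunction.coe_smul,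
      Pi.add_apply, smul_eq_mul]
    ring
  rw [h1]
  calc _ ≤ |a * (f x - f y)| + |b * (g x - g y)| := abs_add_le _ _
    _ = a * |f x - f y| + b * |g x - g y| := by
        rw [abs_mul, abs_mul, abs_of_nonneg ha, abs_of_nonneg hb]
    _ ≤ a * (c * dist x y) + b * (c * dist x y) := by gcongr; exacts [hf x y, hg x y]
    _ = c * dist x y := by rw [← add_mul, hab, one_mul]

theorem zero_mem_lipBall (x₀ : X) {c : ℝ} (hc : 0 ≤ c) : (0 : X →ᵇ ℝ) ∈ lipBall x₀ c :=
  ⟨rfl, fun x y => by simpa using mul_nonneg hc dist_nonneg⟩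

theorem isLip_of_forall_abs_le {f : X → ℝ} {c : ℝ} (h : ∀ x y, |f x - f y| ≤ c * dist x y) :
    IsLip f := by
  refine ⟨c.toNNReal, LipschitzWith.of_dist_le_mul fun x y => ?_⟩
  rw [Real.dist_eq]
  exact (h x y).trans (mul_le_mul_of_nonneg_right (Real.le_coe_toNNReal c) dist_nonneg)

theorem lipNorm_nonneg (f : X → ℝ) : 0 ≤ lipNorm f :=
  Real.sSup_nonneg (by rintro r ⟨x, y, -, rfl⟩; positivity)

theorem lipNorm_le {f : X → ℝ} {c : ℝ} (hc : 0 ≤ c) (h : ∀ x y, |f x - f y| ≤ c * dist x y) :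
    lipNorm f ≤ c := by
  refine Real.sSup_le ?_ hc
  rintro r ⟨x, y, hxy, rfl⟩
  exact (div_le_iff₀ (dist_pos.2 hxy)).2 (h x y)

theorem abs_sub_le_lipNorm_mul {f : X → ℝ} (hf : IsLip f) (x y : X) :
    |f x - f y| ≤ lipNorm f * dist x y := by
  obtain ⟨K, hK⟩ := hf
  rcases eq_or_ne x y with rfl | hxy
  · simp
  · rw [← div_le_iff₀ (dist_pos.2 hxy)]
    refine le_csSup ⟨K, ?_⟩ ⟨x, y, hxy, rfl⟩
    rintro r ⟨x, y, hxy, rfl⟩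
    rw [div_le_iff₀ (dist_pos.2 hxy)]
    exact hK.dist_le_mul x y

theorem IsLip.continuous {f : X → ℝ} (hf : IsLip f) : Continuous f := hf.choose_spec.continuous

end LipBall

/-! ### Integrals and mixtures -/

section Mix

variable {X : Type*} [MeasurableSpace X]

/-- The mixture `t ξ₁ + (1 - t) ξ₂` of two probability measures. -/
def mix (ξ₁ ξ₂ : ProbabilityMeasure X) (t : ℝ) (h0 : 0 ≤ t) (h1 : t ≤ 1) :
    ProbabilityMeasure X :=
  ⟨t.toNNReal • (ξ₁ : Measure X) + (1 - t).toNNReal • (ξ₂ : Measure X), ⟨by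
    simp only [Measure.coe_add, Measure.coe_nnreal_smul_apply, Pi.add_apply, measure_univ, mul_one]
    rw [← ENNReal.coe_add, ← Real.toNNReal_add h0 (by linarith)]
    simp⟩⟩

theorem coe_mix (ξ₁ ξ₂ : ProbabilityMeasure X) {t : ℝ} (h0 : 0 ≤ t) (h1 : t ≤ 1) :
    (mix ξ₁ ξ₂ t h0 h1 : Measure X) =
      t.toNNReal • (ξ₁ : Measure X) + (1 - t).toNNReal • (ξ₂ : Measure X) := rfl

theorem integrable_of_continuous [TopologicalSpace X] [CompactSpace X] [BorelSpace X]
    {f : X → ℝ} (hf : Continuous f) (ξ : Measure X) [IsFiniteMeasure ξ] : Integrable f ξ :=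
  hf.integrable_of_hasCompactSupport (HasCompactSupport.of_compactSpace f)

theorem integral_mix [TopologicalSpace X] [CompactSpace X] [BorelSpace X] {f : X → ℝ}
    (hf : Continuous f) (ξ₁ ξ₂ : ProbabilityMeasure X) {t : ℝ} (h0 : 0 ≤ t) (h1 : t ≤ 1) :
    ∫ x, f x ∂(mix ξ₁ ξ₂ t h0 h1 : Measure X) =
      t * ∫ x, f x ∂(ξ₁ : Measure X) + (1 - t) * ∫ x, f x ∂(ξ₂ : Measure X) := by
  rw [coe_mix, integral_add_measure (integrable_of_continuous hf _)
    (integrable_of_continuous hf _), integral_smul_nnreal_measure, integral_smul_nnreal_measure]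
  simp [NNReal.smul_def, h0, h1]

end Mix

/-! ### Kantorovich–Rubinstein duality -/

section Kantorovich

variable {X : Type*} [MetricSpace X] [MeasurableSpace X]

theorem bddBelow_coupling_costs (μ ξ : ProbabilityMeasure X) :
    BddBelow {r : ℝ | ∃ π : ProbabilityMeasure (X × X), IsCoupling μ ξ π ∧
      r = ∫ p, dist p.1 p.2 ∂(π : Measure (X × X))} :=
  ⟨0, by rintro r ⟨π, -, rfl⟩; exact integral_nonneg fun _ => dist_nonneg⟩

theorem exists_isCoupling {Y : Type*} [MeasurableSpace Y] (μ ξ : ProbabilityMeasure Y) :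
    ∃ π : ProbabilityMeasure (Y × Y), IsCoupling μ ξ π := by
  refine ⟨⟨(μ : Measure Y).prod (ξ : Measure Y), inferInstance⟩, ?_, ?_⟩
  · simp
  · simp

theorem W1_nonneg (μ ξ : ProbabilityMeasure X) : 0 ≤ W1 μ ξ :=
  Real.sInf_nonneg (by rintro r ⟨π, -, rfl⟩; exact integral_nonneg fun _ => dist_nonneg)

/-- The costs of the functions `g ⊕ h + t d` dominating `F`, where `d` is given the cost `S`. -/
def superCosts (μ ξ : ProbabilityMeasure X) (S : ℝ) (F : C(X × X, ℝ)) : Set ℝ :=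
  {r | ∃ g h : C(X, ℝ), ∃ t : ℝ, 0 ≤ t ∧ (∀ x y, F (x, y) ≤ g x + h y + t * dist x y) ∧
    r = ∫ x, g x ∂(μ : Measure X) + ∫ x, h x ∂(ξ : Measure X) + t * S}

theorem mul_mem_superCosts {μ ξ : ProbabilityMeasure X} {S : ℝ} {F : C(X × X, ℝ)} {c r : ℝ}
    (hc : 0 < c) (hr : r ∈ superCosts μ ξ S F) : c * r ∈ superCosts μ ξ S (c • F) := by
  obtain ⟨g, h, t, ht, hle, rfl⟩ := hr
  refine ⟨c • g, c • h, c * t, by positivity, fun x y => ?_, ?_⟩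
  · simp only [ContinuousMap.smul_apply, smul_eq_mul]
    have := mul_le_mul_of_nonneg_left (hle x y) hc.le
    linarith
  · simp only [ContinuousMap.smul_apply, smul_eq_mul, integral_const_mul]
    ring

variable [CompactSpace X]

theorem superCosts_nonempty (μ ξ : ProbabilityMeasure X) (S : ℝ) (F : C(X × X, ℝ)) :
    (superCosts μ ξ S F).Nonempty :=
  ⟨_, ContinuousMap.const X ‖F‖, 0, 0, le_rfl, fun x y => by
    simpa using (le_abs_self _).trans (F.norm_coe_le_norm (x, y)), rfl⟩

variable [BorelSpace X]

theorem integral_sub_le_mul_W1 (μ ξ : ProbabilityMeasure X) {f : X → ℝ} {c : ℝ} (hc : 0 ≤ c)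
    (hf : ∀ x y, |f x - f y| ≤ c * dist x y) :
    ∫ x, f x ∂(μ : Measure X) - ∫ x, f x ∂(ξ : Measure X) ≤ c * W1 μ ξ := by
  have hcont : Continuous f := (isLip_of_forall_abs_le hf).continuous
  have key : ∀ π : ProbabilityMeasure (X × X), IsCoupling μ ξ π →
      ∫ x, f x ∂(μ : Measure X) - ∫ x, f x ∂(ξ : Measure X) ≤
        c * ∫ p, dist p.1 p.2 ∂(π : Measure (X × X)) := by
    rintro π ⟨h1, h2⟩
    rw [← h1, ← h2, integral_map measurable_fst.aemeasurable hcont.aestronglyMeasurable,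
      integral_map measurable_snd.aemeasurable hcont.aestronglyMeasurable, ← integral_sub,
      ← integral_const_mul]
    · refine integral_mono ?_ ?_ fun p => (le_abs_self _).trans (hf p.1 p.2)
      · exact integrable_of_continuous (by fun_prop) _
      · exact integrable_of_continuous (by fun_prop) _
    · exact integrable_of_continuous (hcont.comp continuous_fst) _
    · exact integrable_of_continuous (hcont.comp continuous_snd) _
  obtain ⟨π₀, hπ₀⟩ := exists_isCoupling μ ξ
  rcases hc.eq_or_lt with rfl | hc
  · simpa using key π₀ hπ₀
  rw [← div_le_iff₀' hc]
  refine le_csInf ⟨_, π₀, hπ₀, rfl⟩ ?_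
  rintro r ⟨π, hπ, rfl⟩
  rw [div_le_iff₀' hc]
  exact key π hπ

theorem integral_continuousMap_add (μ : ProbabilityMeasure X) (g h : C(X, ℝ)) :
    ∫ x, (g + h) x ∂(μ : Measure X) = ∫ x, g x ∂(μ : Measure X) + ∫ x, h x ∂(μ : Measure X) :=
  integral_add (integrable_of_continuous g.continuous _) (integrable_of_continuous h.continuous _)

/-- The infimal convolution `u y = ⨅ x, g x + t * dist x y` is `t`-Lipschitz and satisfies `-h ≤ u ≤
g`. Hence `∫ g dμ + ∫ h dξ ≥ ∫ u dμ - ∫ u dξ`, which is at least `-t * S` by `hS` for `-u`. -/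
theorem superCosts_zero_nonneg (x₀ : X) {μ ξ : ProbabilityMeasure X} {S : ℝ}
    (hS : ∀ (f : X → ℝ) (t : ℝ), 0 ≤ t → (∀ x y, |f x - f y| ≤ t * dist x y) →
      ∫ x, f x ∂(μ : Measure X) - ∫ x, f x ∂(ξ : Measure X) ≤ t * S)
    {r : ℝ} (hr : r ∈ superCosts μ ξ S 0) : 0 ≤ r := by
  obtain ⟨g, h, t, ht, hle, rfl⟩ := hr
  have : Nonempty X := ⟨x₀⟩
  have hbdd : ∀ y, BddBelow (Set.range fun x => g x + t * dist x y) := fun y => by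
    refine ⟨-h y, ?_⟩
    rintro _ ⟨x, rfl⟩
    have := hle x y
    simp only [ContinuousMap.zero_apply] at this
    show -h y ≤ g x + t * dist x y
    linarith
  let u : X → ℝ := fun y => ⨅ x, g x + t * dist x y
  have hu1 : ∀ y, u y ≤ g y := fun y => (ciInf_le (hbdd y) y).trans (by simp)
  have hu2 : ∀ y, -h y ≤ u y := fun y => le_ciInf fun x => by
    have := hle x y
    simp only [ContinuousMap.zero_apply] at this
    linarith
  have hu3 : ∀ y z, u y - u z ≤ t * dist y z := fun y z => by
    rw [sub_le_iff_le_add', ← sub_le_iff_le_add]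
    refine le_ciInf fun x => ?_
    have h1 : u y ≤ g x + t * dist x y := ciInf_le (hbdd y) x
    have h2 : t * dist x y ≤ t * (dist x z + dist y z) := by
      gcongr
      simpa [dist_comm z y] using dist_triangle x z y
    linarith
  have hu4 : ∀ y z, |(-u y) - (-u z)| ≤ t * dist y z := fun y z => by
    rw [abs_le]
    have h1 := hu3 y z
    have h2 := hu3 z y
    rw [dist_comm] at h2
    constructor <;> linarith
  have hcont : Continuous u := by
    simpa [Pi.neg_def] using (isLip_of_forall_abs_le hu4).continuous.neg
  have h1 := hS _ t ht hu4
  rw [integral_neg, integral_neg] at h1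
  have h2 : ∫ x, u x ∂(μ : Measure X) ≤ ∫ x, g x ∂(μ : Measure X) :=
    integral_mono (integrable_of_continuous hcont _)
      (integrable_of_continuous g.continuous _) hu1
  have h3 : ∫ x, -h x ∂(ξ : Measure X) ≤ ∫ x, u x ∂(ξ : Measure X) :=
    integral_mono (integrable_of_continuous h.continuous.neg _)
      (integrable_of_continuous hcont _) hu2
  rw [integral_neg] at h3
  linarith

/-- Adding the constant `‖F‖` to `g` reduces to the case `F = 0`. -/
theorem superCosts_bddBelow (x₀ : X) {μ ξ : ProbabilityMeasure X} {S : ℝ}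
    (hS : ∀ (f : X → ℝ) (t : ℝ), 0 ≤ t → (∀ x y, |f x - f y| ≤ t * dist x y) →
      ∫ x, f x ∂(μ : Measure X) - ∫ x, f x ∂(ξ : Measure X) ≤ t * S) (F : C(X × X, ℝ)) :
    BddBelow (superCosts μ ξ S F) := by
  refine ⟨-‖F‖, ?_⟩
  rintro r ⟨g, h, t, ht, hle, rfl⟩
  have := superCosts_zero_nonneg x₀ hS (r := ∫ x, (g + ContinuousMap.const X ‖F‖) x ∂(μ : Measure X)
    + ∫ x, h x ∂(ξ : Measure X) + t * S) ⟨g + ContinuousMap.const X ‖F‖, h, t, ht, fun x y => by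
      have h1 := (neg_le_abs _).trans (F.norm_coe_le_norm (x, y))
      have h2 := hle x y
      simp only [ContinuousMap.zero_apply, ContinuousMap.add_apply, ContinuousMap.const_apply]
      linarith, rfl⟩
  rw [integral_continuousMap_add] at this
  simp only [ContinuousMap.const_apply, integral_const, probReal_univ, one_smul] at this
  linarith

theorem add_mem_superCosts {μ ξ : ProbabilityMeasure X} {S : ℝ} {F G : C(X × X, ℝ)} {r s : ℝ}
    (hr : r ∈ superCosts μ ξ S F) (hs : s ∈ superCosts μ ξ S G) :
    r + s ∈ superCosts μ ξ S (F + G) := by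
  obtain ⟨g, h, t, ht, hle, rfl⟩ := hr
  obtain ⟨g', h', t', ht', hle', rfl⟩ := hs
  refine ⟨g + g', h + h', t + t', by positivity, fun x y => ?_, ?_⟩
  · simp only [ContinuousMap.add_apply]
    linarith [hle x y, hle' x y]
  · rw [integral_continuousMap_add, integral_continuousMap_add]
    ring

/-- A linear functional dominated by the infimal costs. -/
theorem exists_linearMap_le_superCosts (x₀ : X) {μ ξ : ProbabilityMeasure X} {S : ℝ}
    (hS : ∀ (f : X → ℝ) (t : ℝ), 0 ≤ t → (∀ x y, |f x - f y| ≤ t * dist x y) →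
      ∫ x, f x ∂(μ : Measure X) - ∫ x, f x ∂(ξ : Measure X) ≤ t * S) :
    ∃ L : C(X × X, ℝ) →ₗ[ℝ] ℝ, ∀ F, ∀ r ∈ superCosts μ ξ S F, L F ≤ r := by
  have hbdd := superCosts_bddBelow x₀ hS
  have hne := superCosts_nonempty μ ξ S
  have hmul : ∀ c : ℝ, 0 < c → ∀ F, sInf (superCosts μ ξ S (c • F)) ≤
      c * sInf (superCosts μ ξ S F) := fun c hc F => by
    rw [← div_le_iff₀' hc]
    refine le_csInf (hne F) fun r hr => ?_
    rw [div_le_iff₀' hc]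
    exact csInf_le (hbdd _) (mul_mem_superCosts hc hr)
  -- The infimal cost is sublinear in `F` and nonnegative at `0`, so the zero functional on the
  -- trivial subspace extends.
  obtain ⟨L, -, hL⟩ := exists_extension_of_le_sublinear
    (⟨⊥, 0⟩ : C(X × X, ℝ) →ₗ.[ℝ] ℝ) (fun F => sInf (superCosts μ ξ S F))
    (fun c hc F => le_antisymm (hmul c hc F) (by
      have := hmul c⁻¹ (inv_pos.2 hc) (c • F)
      rw [inv_smul_smul₀ hc.ne'] at this
      rwa [inv_mul_eq_div, le_div_iff₀' hc] at this))
    (fun F G => by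
      rw [← sub_le_iff_le_add]
      refine le_csInf (hne F) fun r hr => ?_
      rw [sub_le_comm]
      refine le_csInf (hne G) fun s hs => ?_
      rw [sub_le_iff_le_add']
      exact csInf_le (hbdd _) (add_mem_superCosts hr hs))
    (fun F => by
      obtain ⟨F, hF⟩ := F
      obtain rfl : F = 0 := by simpa using hF
      exact le_csInf (hne 0) fun r hr => superCosts_zero_nonneg x₀ hS hr)
  exact ⟨L, fun F r hr => (hL F).trans (csInf_le (hbdd F) hr)⟩

/-- The functional `L` is positive, because `0` is a cost for `-F` when `F ≥ 0`. Testing `F` and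
`-F` fixes its values on sums `g ⊕ h`, so its Riesz measure has marginals `μ` and `ξ`. The distance
itself is dominated with `t = 1` at cost `S`. -/
theorem exists_isCoupling_integral_dist_le (x₀ : X) {μ ξ : ProbabilityMeasure X} {S : ℝ}
    (hS : ∀ (f : X → ℝ) (t : ℝ), 0 ≤ t → (∀ x y, |f x - f y| ≤ t * dist x y) →
      ∫ x, f x ∂(μ : Measure X) - ∫ x, f x ∂(ξ : Measure X) ≤ t * S) :
    ∃ π : ProbabilityMeasure (X × X), IsCoupling μ ξ π ∧
      ∫ p, dist p.1 p.2 ∂(π : Measure (X × X)) ≤ S := by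
  obtain ⟨L, hL⟩ := exists_linearMap_le_superCosts x₀ hS
  have hpos : ∀ F : C(X × X, ℝ), (∀ p, 0 ≤ F p) → 0 ≤ L F := fun F hF => by
    have := hL (-F) 0 ⟨0, 0, 0, le_rfl, fun x y => by simpa using hF (x, y), by simp⟩
    rw [map_neg] at this
    linarith
  have hsum : ∀ g h : C(X, ℝ), ∀ F : C(X × X, ℝ), (∀ x y, F (x, y) = g x + h y) →
      L F = ∫ x, g x ∂(μ : Measure X) + ∫ x, h x ∂(ξ : Measure X) := fun g h F hF => by
    refine le_antisymm (hL F _ ⟨g, h, 0, le_rfl, fun x y => by simp [hF], by simp⟩) ?_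
    have := hL (-F) _ ⟨-g, -h, 0, le_rfl, fun x y => by simp [hF], rfl⟩
    rw [map_neg] at this
    simp only [ContinuousMap.neg_apply, integral_neg] at this
    linarith
  let Λ : CompactlySupportedContinuousMap (X × X) ℝ →ₚ[ℝ] ℝ := PositiveLinearMap.mk₀
    { toFun := fun F => L F.toContinuousMap
      map_add' := fun F G => L.map_add F.toContinuousMap G.toContinuousMap
      map_smul' := fun c F => L.map_smul c F.toContinuousMap }
    (fun F hF => hpos _ fun p => hF p)
  let m : Measure (X × X) := RealRMK.rieszMeasure Λ
  have hm : ∀ F : C(X × X, ℝ), ∫ p, F p ∂m = L F := fun F =>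
    RealRMK.integral_rieszMeasure Λ (CompactlySupportedContinuousMap.continuousMapEquiv F)
  have hfin : IsFiniteMeasure m := inferInstance
  have hprob : IsProbabilityMeasure m := by
    refine ⟨?_⟩
    have h1 := hm 1
    rw [hsum 1 0 1 (fun x y => by simp)] at h1
    simp only [ContinuousMap.one_apply, integral_const, smul_eq_mul, mul_one,
      ContinuousMap.zero_apply, mul_zero, probReal_univ, add_zero] at h1
    rw [← ofReal_measureReal, h1, ENNReal.ofReal_one]
  have hfst := Measure.isProbabilityMeasure_map (μ := m) measurable_fst.aemeasurable
  have hsnd := Measure.isProbabilityMeasure_map (μ := m) measurable_snd.aemeasurable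
  refine ⟨⟨m, hprob⟩, ⟨?_, ?_⟩, ?_⟩
  · rw [ProbabilityMeasure.coe_mk]
    refine ext_of_forall_integral_eq_of_IsFiniteMeasure fun g => ?_
    rw [integral_map measurable_fst.aemeasurable g.continuous.aestronglyMeasurable]
    refine (hm ⟨fun p => g p.1, by fun_prop⟩).trans ?_
    rw [hsum g.toContinuousMap 0 _ (fun x y => by simp)]
    simp
  · rw [ProbabilityMeasure.coe_mk]
    refine ext_of_forall_integral_eq_of_IsFiniteMeasure fun g => ?_
    rw [integral_map measurable_snd.aemeasurable g.continuous.aestronglyMeasurable]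
    refine (hm ⟨fun p => g p.2, by fun_prop⟩).trans ?_
    rw [hsum 0 g.toContinuousMap _ (fun x y => by simp)]
    simp
  · refine (hm ⟨fun p => dist p.1 p.2, by fun_prop⟩).trans_le ?_
    exact hL _ _ ⟨0, 0, 1, zero_le_one, fun x y => by simp, by simp⟩

open BoundedContinuousFunction in
theorem continuous_integral_boundedContinuousFunction (η : Measure X) [IsProbabilityMeasure η] :
    Continuous fun f : X →ᵇ ℝ => ∫ x, f x ∂η := by
  refine LipschitzWith.continuous (K := 1) (LipschitzWith.of_dist_le_mul fun f g => ?_)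
  rw [Real.dist_eq, ← integral_sub (integrable_of_continuous f.continuous _)
    (integrable_of_continuous g.continuous _), NNReal.coe_one, one_mul, dist_eq_norm]
  exact (f - g).norm_integral_le_norm η

open BoundedContinuousFunction in
/-- **Kantorovich–Rubinstein duality**, with an optimal function vanishing at `x₀`. -/
theorem exists_mem_lipBall_W1_eq (x₀ : X) (μ ξ : ProbabilityMeasure X) :
    ∃ f ∈ lipBall x₀ 1,
      W1 μ ξ = ∫ x, f x ∂(μ : Measure X) - ∫ x, f x ∂(ξ : Measure X) := by
  obtain ⟨f, hf, hmax⟩ := (isCompact_lipBall x₀ zero_le_one).exists_isMaxOn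
    ⟨0, zero_mem_lipBall x₀ zero_le_one⟩
    (f := fun f : X →ᵇ ℝ => ∫ x, f x ∂(μ : Measure X) - ∫ x, f x ∂(ξ : Measure X))
    ((continuous_integral_boundedContinuousFunction _).sub
      (continuous_integral_boundedContinuousFunction _)).continuousOn
  refine ⟨f, hf, le_antisymm ?_ ?_⟩
  · have hS : ∀ (g : X → ℝ) (t : ℝ), 0 ≤ t → (∀ x y, |g x - g y| ≤ t * dist x y) →
        ∫ x, g x ∂(μ : Measure X) - ∫ x, g x ∂(ξ : Measure X) ≤
          t * (∫ x, f x ∂(μ : Measure X) - ∫ x, f x ∂(ξ : Measure X)) := by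
      intro g t ht hg
      rcases ht.eq_or_lt with rfl | ht
      · simpa using integral_sub_le_mul_W1 μ ξ le_rfl hg
      · have hcont : Continuous g := (isLip_of_forall_abs_le hg).continuous
        let k : X →ᵇ ℝ := BoundedContinuousFunction.mkOfCompact
          ⟨fun x => t⁻¹ * (g x - g x₀), by fun_prop⟩
        have hk : k ∈ lipBall x₀ 1 := by
          refine ⟨by simp [k], fun x y => ?_⟩
          have : k x - k y = t⁻¹ * (g x - g y) := by simp [k]; ring
          rw [this, abs_mul, abs_of_pos (inv_pos.2 ht), one_mul, inv_mul_le_iff₀ ht]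
          exact hg x y
        have hint : ∀ η : ProbabilityMeasure X, ∫ x, k x ∂(η : Measure X) =
            t⁻¹ * (∫ x, g x ∂(η : Measure X) - g x₀) := fun η => by
          simp only [k, BoundedContinuousFunction.mkOfCompact_apply, ContinuousMap.coe_mk]
          rw [integral_const_mul, integral_sub (integrable_of_continuous hcont _)
            (integrable_const _)]
          simp
        have h1 : ∫ x, k x ∂(μ : Measure X) - ∫ x, k x ∂(ξ : Measure X) ≤
          ∫ x, f x ∂(μ : Measure X) - ∫ x, f x ∂(ξ : Measure X) := hmax hk
        rw [hint, hint, ← mul_sub, inv_mul_le_iff₀ ht] at h1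
        linarith
    obtain ⟨π, hπ, hle⟩ := exists_isCoupling_integral_dist_le x₀ hS
    exact (csInf_le (bddBelow_coupling_costs μ ξ) ⟨π, hπ, rfl⟩).trans hle
  · simpa using integral_sub_le_mul_W1 μ ξ zero_le_one hf.2

/-- By duality `W1 μ` is a supremum of functionals affine in the second measure. -/
theorem W1_mix_le (x₀ : X) (μ ξ₁ ξ₂ : ProbabilityMeasure X) {t : ℝ} (h0 : 0 ≤ t) (h1 : t ≤ 1) :
    W1 μ (mix ξ₁ ξ₂ t h0 h1) ≤ t * W1 μ ξ₁ + (1 - t) * W1 μ ξ₂ := by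
  obtain ⟨f, hf, heq⟩ := exists_mem_lipBall_W1_eq x₀ μ (mix ξ₁ ξ₂ t h0 h1)
  rw [heq, integral_mix f.continuous]
  have h2 := integral_sub_le_mul_W1 μ ξ₁ zero_le_one hf.2
  have h3 := integral_sub_le_mul_W1 μ ξ₂ zero_le_one hf.2
  nlinarith [mul_le_mul_of_nonneg_left h2 h0, mul_le_mul_of_nonneg_left h3 (sub_nonneg.2 h1)]

/-- Lipschitz functions have equal integrals, and they determine weak convergence; so the constant
sequence `μ` converges to `ξ`, and weak limits are unique. -/
theorem eq_of_W1_eq_zero {μ ξ : ProbabilityMeasure X} (h : W1 μ ξ = 0) : μ = ξ := by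
  have key : ∀ f : X → ℝ, (∃ L, LipschitzWith L f) →
      ∫ x, f x ∂(μ : Measure X) = ∫ x, f x ∂(ξ : Measure X) := by
    rintro f ⟨L, hL⟩
    have h1 := integral_sub_le_mul_W1 μ ξ L.2 fun x y => hL.dist_le_mul x y
    have h2 := integral_sub_le_mul_W1 μ ξ (f := fun x => -f x) L.2 fun x y => by
      have := hL.dist_le_mul x y
      rwa [Real.dist_eq, ← abs_neg, neg_sub, ← neg_sub_neg] at this
    rw [integral_neg, integral_neg] at h2
    rw [h] at h1 h2
    linarith
  have ht : Tendsto (fun _ : ℕ => μ) atTop (𝓝 ξ) :=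
    tendsto_iff_forall_lipschitz_integral_tendsto.2 fun f _ hf => by
      rw [key f hf]
      exact tendsto_const_nhds
  exact tendsto_nhds_unique tendsto_const_nhds ht

end Kantorovich

/-! ### Affine minorants of a divergence function -/

section Subgradient

variable {φ : ℝ → EReal}

theorem IsDivergenceFunction.coe_toReal (hφ : IsDivergenceFunction φ) {x : ℝ}
    (hx : x ∈ effDom φ) : ((φ x).toReal : EReal) = φ x :=
  EReal.coe_toReal (ne_of_lt hx) (hφ.proper.2 x)

/-- A second point makes the affine span the whole line, so the relative interior is the interior.
-/
theorem IsDivergenceFunction.effDom_mem_nhds (hφ : IsDivergenceFunction φ) {x : ℝ}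
    (hx : x ∈ effDom φ) (hx1 : x ≠ 1) : effDom φ ∈ 𝓝 (1 : ℝ) := by
  have h1 : (1 : ℝ) ∈ effDom φ := intrinsicInterior_subset hφ.one_mem_relint
  have hspan : ∀ y : ℝ, y ∈ affineSpan ℝ (effDom φ) := fun y => by
    have h2 := AffineMap.lineMap_mem_affineSpan_pair ((y - 1) / (x - 1)) (1 : ℝ) x
    have h3 : AffineMap.lineMap (1 : ℝ) x ((y - 1) / (x - 1)) = y := by
      rw [AffineMap.lineMap_apply_module']
      simp only [smul_eq_mul]
      rw [div_mul_cancel₀ _ (sub_ne_zero.2 hx1)]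
      ring
    rw [h3] at h2
    exact affineSpan_mono ℝ (Set.pair_subset h1 hx) h2
  obtain ⟨y, hy, hy1⟩ := hφ.one_mem_relint
  rw [mem_interior_iff_mem_nhds, nhds_subtype, hy1, mem_comap] at hy
  obtain ⟨U, hU, hUs⟩ := hy
  exact mem_of_superset hU fun z hz => hUs (a := ⟨z, hspan z⟩) hz

theorem IsDivergenceFunction.slope_le (hφ : IsDivergenceFunction φ) {x y : ℝ}
    (hx : x ∈ effDom φ) (hy : y ∈ effDom φ) (hx1 : x < 1) (hy1 : 1 < y) :
    -(φ x).toReal / (1 - x) ≤ (φ y).toReal / (y - 1) := by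
  have hxy : 0 < y - x := by linarith
  have h := hφ.convex x y ((y - 1) / (y - x)) (div_nonneg (by linarith) hxy.le)
    ((div_le_one hxy).2 (by linarith))
  have h1 : (y - 1) / (y - x) * x + (1 - (y - 1) / (y - x)) * y = 1 := by
    field_simp
    ring
  rw [h1, hφ.map_one, ← hφ.coe_toReal hx, ← hφ.coe_toReal hy] at h
  norm_cast at h
  have h2 : (y - 1) / (y - x) * (φ x).toReal + (1 - (y - 1) / (y - x)) * (φ y).toReal =
      ((y - 1) * (φ x).toReal + (1 - x) * (φ y).toReal) / (y - x) := by
    field_simp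
    ring
  rw [h2, le_div_iff₀ hxy, zero_mul] at h
  rw [div_le_div_iff₀ (by linarith) (by linarith)]
  linarith

theorem IsDivergenceFunction.exists_subgradient (hφ : IsDivergenceFunction φ) :
    ∃ s : ℝ, ∀ x : ℝ, ((s * (x - 1) : ℝ) : EReal) ≤ φ x := by
  -- The slopes of the chords from points left of `1` to `(1, 0)`; their supremum is the left
  -- derivative at `1`. By `slope_le` they lie below all slopes on the right. If the domain is only
  -- `{1}`, the set is empty and the default `sSup ∅ = 0` serves as well as any slope.
  set A : Set ℝ := {r | ∃ x ∈ effDom φ, x < 1 ∧ r = -(φ x).toReal / (1 - x)} with hA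
  refine ⟨sSup A, fun x => ?_⟩
  by_cases hx : x ∈ effDom φ
  swap
  · have : φ x = ⊤ := by simpa [effDom] using hx
    simp [this]
  rcases eq_or_ne x 1 with rfl | hx1
  · simp [hφ.map_one]
  have hnhds := hφ.effDom_mem_nhds hx hx1
  obtain ⟨y, hy, hy1⟩ : ∃ y ∈ effDom φ, 1 < y := by
    obtain ⟨y, hy⟩ := nonempty_of_mem (inter_mem
      (mem_nhdsWithin_of_mem_nhds (t := Set.Ioi 1) hnhds) self_mem_nhdsWithin)
    exact ⟨y, hy.1, hy.2⟩
  obtain ⟨z, hz, hz1⟩ : ∃ z ∈ effDom φ, z < 1 := by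
    obtain ⟨y, hy⟩ := nonempty_of_mem (inter_mem
      (mem_nhdsWithin_of_mem_nhds (t := Set.Iio 1) hnhds) self_mem_nhdsWithin)
    exact ⟨y, hy.1, hy.2⟩
  rw [← hφ.coe_toReal hx, EReal.coe_le_coe_iff]
  rcases hx1.lt_or_gt with hlt | hgt
  · have h1 : -(φ x).toReal / (1 - x) ≤ sSup A := by
      refine le_csSup ⟨(φ y).toReal / (y - 1), ?_⟩ ⟨x, hx, hlt, rfl⟩
      rintro r ⟨w, hw, hw1, rfl⟩
      exact hφ.slope_le hw hy hw1 hy1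
    rw [div_le_iff₀ (by linarith)] at h1
    linarith
  · have h1 : sSup A ≤ (φ x).toReal / (x - 1) := by
      refine csSup_le ⟨_, z, hz, hz1, rfl⟩ ?_
      rintro r ⟨w, hw, hw1, rfl⟩
      exact hφ.slope_le hw hx hw1 hgt
    rwa [le_div_iff₀ (by linarith)] at h1

theorem le_slopeAtTop {s : ℝ} (hs : ∀ x : ℝ, ((s * (x - 1) : ℝ) : EReal) ≤ φ x) :
    (s : EReal) ≤ slopeAtTop φ := by
  have h1 : Tendsto (fun x : ℝ => s - s * x⁻¹) atTop (𝓝 s) := by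
    simpa using (tendsto_inv_atTop_zero.const_mul s).const_sub s
  have h2 : Tendsto (fun x : ℝ => ((s - s * x⁻¹ : ℝ) : EReal)) atTop (𝓝 (s : EReal)) :=
    (continuous_coe_real_ereal.tendsto s).comp h1
  rw [← h2.limsup_eq]
  refine limsup_le_limsup ?_
  filter_upwards [eventually_gt_atTop 0] with x hx
  have h3 : s - s * x⁻¹ = s * (x - 1) / x := by
    field_simp
  rw [h3, EReal.coe_div]
  exact EReal.div_le_div_right_of_nonneg (by exact_mod_cast hx.le) (hs x)

/-- The excess of `φ` over the affine function of slope `s` through `(1, 0)`. -/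
def excess (φ : ℝ → EReal) (s x : ℝ) : ℝ≥0∞ := (φ x - ((s * (x - 1) : ℝ) : EReal)).toENNReal

theorem coe_add_excess {s x : ℝ} (hs : ((s * (x - 1) : ℝ) : EReal) ≤ φ x) :
    ((s * (x - 1) : ℝ) : EReal) + (excess φ s x : EReal) = φ x := by
  rw [excess]
  generalize s * (x - 1) = r at *
  rw [EReal.coe_toENNReal (EReal.sub_nonneg (by simp) (by simp) |>.2 hs)]
  induction h : φ x using EReal.rec with
  | bot => simp [h] at hs
  | coe a => norm_cast; ring
  | top => simp

theorem excess_ne_top_iff {s x : ℝ} : excess φ s x ≠ ⊤ ↔ φ x ≠ ⊤ := by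
  rw [excess, EReal.toENNReal_ne_top_iff, ne_eq, ne_eq, not_iff_not]
  generalize s * (x - 1) = r
  induction h : φ x using EReal.rec with
  | bot => simp
  | coe a => simp [← EReal.coe_sub, EReal.coe_ne_top]
  | top => simp

theorem measurable_excess (hφ : LowerSemicontinuous φ) (s : ℝ) : Measurable (excess φ s) :=
  (hφ.measurable.sub (by fun_prop)).ereal_toENNReal

theorem IsDivergenceFunction.excess_convex (hφ : IsDivergenceFunction φ) (s x y : ℝ) {t : ℝ}
    (h0 : 0 ≤ t) (h1 : t ≤ 1) :
    excess φ s (t * x + (1 - t) * y) ≤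
      ENNReal.ofReal t * excess φ s x + ENNReal.ofReal (1 - t) * excess φ s y := by
  rcases h0.eq_or_lt with rfl | h0
  · simp
  rcases h1.eq_or_lt with rfl | h1
  · simp
  by_cases hx : φ x = ⊤
  · have : excess φ s x = ⊤ := by
      by_contra h
      exact excess_ne_top_iff.1 h hx
    simp [this, ENNReal.mul_top, h0]
  by_cases hy : φ y = ⊤
  · have : excess φ s y = ⊤ := by
      by_contra h
      exact excess_ne_top_iff.1 h hy
    simp [this, ENNReal.mul_top, h1]
  have hx' := hφ.coe_toReal (lt_top_iff_ne_top.2 hx : x ∈ effDom φ)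
  have hy' := hφ.coe_toReal (lt_top_iff_ne_top.2 hy : y ∈ effDom φ)
  have h := hφ.convex x y t h0.le h1.le
  have hz : t * x + (1 - t) * y ∈ effDom φ := by
    refine lt_of_le_of_lt h ?_
    rw [← hx', ← hy']
    norm_cast
    exact EReal.coe_lt_top _
  have hz' := hφ.coe_toReal hz
  rw [← hx', ← hy', ← hz'] at h
  norm_cast at h
  unfold excess
  rw [← hx', ← hy', ← hz']
  norm_cast
  simp only [EReal.real_coe_toENNReal]
  have h1' : 0 ≤ 1 - t := by linarith
  rw [← ENNReal.ofReal_mul h0.le, ← ENNReal.ofReal_mul h1']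
  refine le_trans (ENNReal.ofReal_le_ofReal ?_) ENNReal.ofReal_add_le
  nlinarith

end Subgradient

/-! ### Convexity of the divergence -/

section Divergence

variable {X : Type*} [MeasurableSpace X]

/-- Written without subtraction, `g⁺ + h⁻ = g⁻ + (h⁺ + u)` is an identity in `ℝ≥0∞` and can be
integrated termwise. Since `g⁻ ≤ h⁻`, only `g⁺` and `u` can have infinite integral. -/
theorem integralEReal_coe_add_coe (ν : Measure X) {h : X → ℝ} (hh : Integrable h ν)
    {u : X → ℝ≥0∞} (hu : Measurable u) {g : X → EReal} (hg : Measurable g)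
    (hgu : ∀ x, g x = (h x : EReal) + (u x : EReal)) :
    integralEReal g ν = ((∫ x, h x ∂ν : ℝ) : EReal) + ((∫⁻ x, u x ∂ν : ℝ≥0∞) : EReal) := by
  have hp : ∀ x, (g x).toENNReal + ENNReal.ofReal (-h x) =
      (-g x).toENNReal + (ENNReal.ofReal (h x) + u x) := by
    intro x
    rw [hgu x]
    induction hux : u x using ENNReal.recTopCoe with
    | top => simp
    | coe a =>
      have h1 : ((a : ℝ≥0∞) : EReal) = ((a : ℝ) : EReal) := rfl
      have h2 : ((a : ℝ≥0) : ℝ≥0∞) = ENNReal.ofReal (a : ℝ) := by simp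
      rw [h1, ← EReal.coe_add, ← EReal.coe_neg, EReal.real_coe_toENNReal,
        EReal.real_coe_toENNReal, h2]
      have ha := a.coe_nonneg
      rcases le_total 0 (h x) with hx | hx <;> rcases le_total 0 (h x + a) with hxa | hxa
      · rw [ENNReal.ofReal_of_nonpos (p := -h x) (by linarith),
          ENNReal.ofReal_of_nonpos (p := -(h x + a)) (by linarith), ENNReal.ofReal_add hx ha]
        simp
      · rw [ENNReal.ofReal_of_nonpos (p := -h x) (by linarith),
          ENNReal.ofReal_of_nonpos (p := h x + a) (by linarith),
          ENNReal.ofReal_of_nonpos (p := h x) (by linarith),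
          ENNReal.ofReal_of_nonpos (p := (a : ℝ)) (by linarith),
          ENNReal.ofReal_of_nonpos (p := -(h x + a)) (by linarith)]
        simp
      · rw [ENNReal.ofReal_of_nonpos (p := h x) hx,
          ENNReal.ofReal_of_nonpos (p := -(h x + a)) (by linarith),
          ← ENNReal.ofReal_add hxa (by linarith)]
        simp
      · rw [ENNReal.ofReal_of_nonpos (p := h x) hx,
          ENNReal.ofReal_of_nonpos (p := h x + a) hxa, zero_add, zero_add,
          ← ENNReal.ofReal_add (by linarith) ha]
        congr 1
        ring
  have hint := lintegral_congr (μ := ν) hp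
  have hgm : Measurable fun x => (-g x).toENNReal := hg.neg.ereal_toENNReal
  rw [lintegral_add_left hg.ereal_toENNReal, lintegral_add_left hgm,
    lintegral_add_right _ hu] at hint
  have hneg : ∫⁻ x, (-g x).toENNReal ∂ν ≠ ⊤ := by
    refine ne_top_of_le_ne_top hh.neg.lintegral_lt_top.ne (lintegral_mono fun x => ?_)
    rw [← EReal.real_coe_toENNReal]
    refine EReal.toENNReal_le_toENNReal ?_
    rw [hgu x, Pi.neg_apply, EReal.coe_neg, EReal.neg_le_neg_iff]
    exact le_add_of_nonneg_right (EReal.coe_ennreal_nonneg _)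
  have h1 : ∫⁻ x, ENNReal.ofReal (-h x) ∂ν ≠ ⊤ := hh.neg.lintegral_lt_top.ne
  have h2 : ∫⁻ x, ENNReal.ofReal (h x) ∂ν ≠ ⊤ := hh.lintegral_lt_top.ne
  rw [integralEReal, integral_eq_lintegral_pos_part_sub_lintegral_neg_part hh]
  generalize ∫⁻ x, (-g x).toENNReal ∂ν = b at *
  generalize ∫⁻ x, ENNReal.ofReal (-h x) ∂ν = c at *
  generalize ∫⁻ x, ENNReal.ofReal (h x) ∂ν = d at *
  generalize ∫⁻ x, (g x).toENNReal ∂ν = a at *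
  generalize ∫⁻ x, u x ∂ν = e at *
  lift b to ℝ≥0 using hneg
  lift c to ℝ≥0 using h1
  lift d to ℝ≥0 using h2
  induction e using ENNReal.recTopCoe with
  | top =>
    have : a = ⊤ := by simpa using hint
    rw [this]
    rfl
  | coe e =>
    have ha : a ≠ ⊤ := by
      rintro rfl
      simp at hint
      norm_cast at hint
    lift a to ℝ≥0 using ha
    norm_cast at hint
    have hreal : (a : ℝ) + c = b + (d + e) := by exact_mod_cast hint
    show ((a : ℝ) : EReal) - ((b : ℝ) : EReal) = (((d : ℝ) - (c : ℝ) : ℝ) : EReal) + ((e : ℝ) : EReal)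
    norm_cast
    linarith

/-- The divergence with the affine part of `φ` removed. -/
def excessDivergence (φ : ℝ → EReal) (s : ℝ) (ν ξ : ProbabilityMeasure X) : ℝ≥0∞ :=
  ∫⁻ x, excess φ s ((ξ : Measure X).rnDeriv ν x).toReal ∂(ν : Measure X) +
    (slopeAtTop φ - (s : EReal)).toENNReal * (ξ : Measure X).singularPart ν Set.univ

/-- The affine part integrates to `s * (ξ_c(X) - 1) = -s * ξ_s(X)`, which is absorbed into the
recession slope; the remaining slope `φ'(∞) - s` is nonnegative by `le_slopeAtTop`. -/
theorem IsDivergenceFunction.divergence_eq {φ : ℝ → EReal} (hφ : IsDivergenceFunction φ) {s : ℝ}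
    (hs : ∀ x : ℝ, ((s * (x - 1) : ℝ) : EReal) ≤ φ x) (ν ξ : ProbabilityMeasure X) :
    divergence φ ξ ν = (excessDivergence φ s ν ξ : EReal) := by
  have hr : Measurable fun x => ((ξ : Measure X).rnDeriv ν x).toReal :=
    (Measure.measurable_rnDeriv _ _).ennreal_toReal
  have hint : Integrable (fun x => s * (((ξ : Measure X).rnDeriv ν x).toReal - 1))
      (ν : Measure X) :=
    (Measure.integrable_toReal_rnDeriv.sub (integrable_const _)).const_mul _
  rw [divergence, excessDivergence, integralEReal_coe_add_coe (g := fun x => φ _) _ hint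
    ((measurable_excess hφ.lsc s).comp hr) (hφ.lsc.measurable.comp hr)
    (fun x => (coe_add_excess (hs _)).symm), integral_const_mul,
    integral_sub Measure.integrable_toReal_rnDeriv (integrable_const _),
    Measure.integral_toReal_rnDeriv']
  have hslope := le_slopeAtTop hs
  have hm : (ξ : Measure X).singularPart ν Set.univ ≠ ⊤ := measure_ne_top _ _
  simp only [integral_const, probReal_univ, one_smul, sub_sub_cancel_left]
  rw [measureReal_def]
  generalize (ξ : Measure X).singularPart ν Set.univ = m at *
  simp only [Function.comp_def]
  generalize ∫⁻ x, excess φ s ((ξ : Measure X).rnDeriv ν x).toReal ∂(ν : Measure X) = e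
  lift m to ℝ≥0 using hm
  generalize slopeAtTop φ = q at *
  simp only [ENNReal.coe_toReal]
  have hm' : ((m : ℝ≥0∞) : EReal) = ((m : ℝ) : EReal) := rfl
  rw [EReal.coe_ennreal_add, EReal.coe_ennreal_mul, add_right_comm, add_comm, hm',
    EReal.coe_toENNReal (EReal.sub_nonneg (by simp) (by simp) |>.2 hslope)]
  congr 1
  induction q using EReal.rec with
  | bot => simp at hslope
  | coe q =>
    norm_cast
    ring
  | top =>
    rcases eq_or_ne m 0 with rfl | hm0
    · simp
    · have hpos : 0 < (m : ℝ) := by exact_mod_cast pos_iff_ne_zero.2 hm0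
      rw [EReal.top_sub_coe, EReal.top_mul_coe_of_pos hpos, EReal.coe_add_top]

theorem IsDivergenceFunction.divergence_self {φ : ℝ → EReal} (hφ : IsDivergenceFunction φ)
    (ν : ProbabilityMeasure X) : divergence φ ν ν = 0 := by
  have h : ∀ᵐ x ∂(ν : Measure X), φ ((ν : Measure X).rnDeriv ν x).toReal = 0 := by
    filter_upwards [Measure.rnDeriv_self (ν : Measure X)] with x hx
    simp [hx, hφ.map_one]
  have h1 : ∫⁻ x, (φ ((ν : Measure X).rnDeriv ν x).toReal).toENNReal ∂(ν : Measure X) = 0 := by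
    rw [lintegral_congr_ae (g := 0) (by filter_upwards [h] with x hx; simp [hx])]
    simp
  have h2 : ∫⁻ x, (-φ ((ν : Measure X).rnDeriv ν x).toReal).toENNReal ∂(ν : Measure X) = 0 := by
    rw [lintegral_congr_ae (g := 0) (by filter_upwards [h] with x hx; simp [hx])]
    simp
  rw [divergence, integralEReal, h1, h2, Measure.singularPart_self]
  simp

/-- Densities and singular parts are linear in the measure, so convexity of the integrand passes to
the integral. -/
theorem IsDivergenceFunction.excessDivergence_mix_le {φ : ℝ → EReal}
    (hφ : IsDivergenceFunction φ) (s : ℝ) (ν ξ₁ ξ₂ : ProbabilityMeasure X) {t : ℝ}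
    (h0 : 0 ≤ t) (h1 : t ≤ 1) :
    excessDivergence φ s ν (mix ξ₁ ξ₂ t h0 h1) ≤
      ENNReal.ofReal t * excessDivergence φ s ν ξ₁ +
        ENNReal.ofReal (1 - t) * excessDivergence φ s ν ξ₂ := by
  unfold excessDivergence
  have hr : ∀ ξ : ProbabilityMeasure X,
      Measurable fun x => excess φ s ((ξ : Measure X).rnDeriv ν x).toReal := fun ξ =>
    (measurable_excess hφ.lsc s).comp (Measure.measurable_rnDeriv _ _).ennreal_toReal
  have hle : ∫⁻ x, excess φ s
        ((mix ξ₁ ξ₂ t h0 h1 : Measure X).rnDeriv ν x).toReal ∂(ν : Measure X) ≤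
      ENNReal.ofReal t * ∫⁻ x, excess φ s ((ξ₁ : Measure X).rnDeriv ν x).toReal ∂(ν : Measure X) +
      ENNReal.ofReal (1 - t) *
        ∫⁻ x, excess φ s ((ξ₂ : Measure X).rnDeriv ν x).toReal ∂(ν : Measure X) := by
    rw [← lintegral_const_mul _ (hr ξ₁), ← lintegral_const_mul _ (hr ξ₂),
      ← lintegral_add_left ((hr ξ₁).const_mul _)]
    refine lintegral_mono_ae ?_
    rw [coe_mix]
    filter_upwards [Measure.rnDeriv_add (t.toNNReal • (ξ₁ : Measure X))
      ((1 - t).toNNReal • (ξ₂ : Measure X)) (ν : Measure X),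
      Measure.rnDeriv_smul_left (ξ₁ : Measure X) (ν : Measure X) t.toNNReal,
      Measure.rnDeriv_smul_left (ξ₂ : Measure X) (ν : Measure X) (1 - t).toNNReal,
      Measure.rnDeriv_lt_top (ξ₁ : Measure X) (ν : Measure X),
      Measure.rnDeriv_lt_top (ξ₂ : Measure X) (ν : Measure X)] with x hx h2 h3 h4 h5
    rw [hx, Pi.add_apply, h2, h3, Pi.smul_apply, Pi.smul_apply, ENNReal.smul_def,
      ENNReal.smul_def, smul_eq_mul, smul_eq_mul,
      ENNReal.toReal_add (ENNReal.mul_ne_top ENNReal.coe_ne_top h4.ne)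
        (ENNReal.mul_ne_top ENNReal.coe_ne_top h5.ne), ENNReal.toReal_mul, ENNReal.toReal_mul,
      ENNReal.coe_toReal, ENNReal.coe_toReal, Real.coe_toNNReal _ h0,
      Real.coe_toNNReal _ (sub_nonneg.2 h1)]
    exact hφ.excess_convex s _ _ h0 h1
  have hsing : (mix ξ₁ ξ₂ t h0 h1 : Measure X).singularPart ν Set.univ =
      ENNReal.ofReal t * (ξ₁ : Measure X).singularPart ν Set.univ +
        ENNReal.ofReal (1 - t) * (ξ₂ : Measure X).singularPart ν Set.univ := by
    rw [coe_mix, Measure.singularPart_add, Measure.singularPart_smul, Measure.singularPart_smul]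
    simp [ENNReal.ofReal]
  rw [hsing]
  calc _ ≤ _ := add_le_add_left hle _
    _ = _ := by ring

theorem tightConjugate_eq {φ : ℝ → EReal} {ν ξ : ProbabilityMeasure X}
    {F : ProbabilityMeasure X → ℝ≥0∞} (hF : ∀ η, divergence φ η ν = (F η : EReal))
    (hξ : F ξ ≠ ⊤) {f : X → ℝ}
    (h : ∀ η, F η ≠ ⊤ → (F ξ).toReal - ∫ x, f x ∂(ξ : Measure X) ≤
      (F η).toReal - ∫ x, f x ∂(η : Measure X)) :
    tightConjugate φ ν f = ((∫ x, f x ∂(ξ : Measure X) - (F ξ).toReal : ℝ) : EReal) := by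
  have hcoe : ∀ η, F η ≠ ⊤ → (F η : EReal) = ((F η).toReal : EReal) := fun η hη =>
    (EReal.coe_ennreal_toReal hη).symm
  refine le_antisymm (iSup_le fun η => ?_) ?_
  · rw [hF]
    by_cases hη : F η = ⊤
    · simp [hη]
    · rw [hcoe η hη, ← EReal.coe_sub, EReal.coe_le_coe_iff]
      linarith [h η hη]
  · refine le_trans (le_of_eq ?_) (le_iSup _ ξ)
    rw [hF, hcoe ξ hξ, EReal.coe_sub]

end Divergence

/-! ### The conjugate of the power function -/

section Penalty

/-- The conjugate of `w ↦ lam * w ^ α` on the nonnegative reals. -/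
def penalty (lam α l : ℝ) : ℝ :=
  (α - 1) * α ^ (α / (1 - α)) * lam ^ (1 / (1 - α)) * l ^ (α / (α - 1))

theorem penalty_eq {lam α : ℝ} (hlam : 0 < lam) (hα : 1 < α) (l : ℝ) :
    penalty lam α l = (α - 1) / α * (α * lam) ^ (1 / (1 - α)) * l ^ (α / (α - 1)) := by
  have hα0 : 0 < α := by linarith
  have h1 : α / (1 - α) = 1 / (1 - α) - 1 := by
    have : (1 - α) ≠ 0 := by linarith
    field_simp
    ring
  rw [penalty, h1, Real.rpow_sub_one hα0.ne', Real.mul_rpow hα0.le hlam.le]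
  ring

theorem mul_le_add_penalty {lam α l w : ℝ} (hlam : 0 < lam) (hα : 1 < α) (hl : 0 ≤ l)
    (hw : 0 ≤ w) : l * w ≤ lam * w ^ α + penalty lam α l := by
  have hα0 : 0 < α := by linarith
  have hα1 : 0 < α - 1 := by linarith
  have hB : 0 < α * lam := by positivity
  have hconj : α.HolderConjugate (α / (α - 1)) := Real.HolderConjugate.conjExponent hα
  -- The factors `(α * lam) ^ (±1 / α)` cancel in the product and turn `w ^ α / α` into `lam * w ^
  -- α`.
  have h := Real.young_inequality_of_nonneg (a := (α * lam) ^ (1 / α) * w)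
    (b := (α * lam) ^ (-(1 / α)) * l) (by positivity) (by positivity) hconj
  have h1 : (α * lam) ^ (1 / α) * w * ((α * lam) ^ (-(1 / α)) * l) = l * w := by
    rw [Real.rpow_neg hB.le]
    have : (α * lam) ^ (1 / α) ≠ 0 := (Real.rpow_pos_of_pos hB _).ne'
    field_simp
  have h2 : ((α * lam) ^ (1 / α) * w) ^ α / α = lam * w ^ α := by
    rw [Real.mul_rpow (by positivity) hw, ← Real.rpow_mul hB.le, one_div_mul_cancel hα0.ne',
      Real.rpow_one]
    field_simp
  have h3 : ((α * lam) ^ (-(1 / α)) * l) ^ (α / (α - 1)) / (α / (α - 1)) = penalty lam α l := by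
    have h4 : -(1 / α) * (α / (α - 1)) = 1 / (1 - α) := by
      have : (1 - α) ≠ 0 := by linarith
      field_simp
      ring
    rw [Real.mul_rpow (by positivity) hl, ← Real.rpow_mul hB.le, h4, penalty_eq hlam hα]
    field_simp
  rw [h1, h2, h3] at h
  exact h

/-- The equality case of Young's inequality, at the derivative of `lam * w ^ α`. -/
theorem penalty_slope {lam α w : ℝ} (hlam : 0 < lam) (hα : 1 < α) (hw : 0 ≤ w) :
    penalty lam α (α * lam * w ^ (α - 1)) = (α - 1) * lam * w ^ α := by
  have hα0 : 0 < α := by linarith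
  have hα1 : α - 1 ≠ 0 := by linarith
  have hB : 0 < α * lam := by positivity
  have h1 : (α * lam) ^ (1 / (1 - α)) * (α * lam) ^ (α / (α - 1)) = α * lam := by
    rw [← Real.rpow_add hB]
    have : 1 / (1 - α) + α / (α - 1) = 1 := by
      have : (1 - α) ≠ 0 := by linarith
      field_simp
      ring
    rw [this, Real.rpow_one]
  rw [penalty_eq hlam hα, Real.mul_rpow hB.le (by positivity), ← Real.rpow_mul hw,
    mul_div_cancel₀ _ hα1]
  calc _ = (α - 1) / α * ((α * lam) ^ (1 / (1 - α)) * (α * lam) ^ (α / (α - 1))) * w ^ α := by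
        ring
    _ = _ := by
        rw [h1]
        field_simp

theorem slope_mul_self {lam α w : ℝ} (hα : 1 ≤ α) (hw : 0 ≤ w) :
    α * lam * w ^ (α - 1) * w = α * lam * w ^ α := by
  rcases hw.eq_or_lt with rfl | hw
  · rw [Real.zero_rpow (by linarith : α ≠ 0)]
    simp
  · rw [Real.rpow_sub_one hw.ne']
    field_simp

/-- First-order optimality along a segment. -/
theorem add_slope_mul_nonneg {lam α w δ a : ℝ} (hα : 1 ≤ α)
    (h : ∀ t : ℝ, 0 < t → t < 1 → 0 ≤ t * a + lam * ((w + t * δ) ^ α - w ^ α)) :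
    0 ≤ a + α * lam * w ^ (α - 1) * δ := by
  -- The right difference quotients at `0` are nonnegative, hence so is the derivative. As `1 ≤ α`,
  -- the power is differentiable even at `w = 0`.
  have hd : HasDerivAt (fun t : ℝ => t * a + lam * ((w + t * δ) ^ α - w ^ α))
      (a + α * lam * w ^ (α - 1) * δ) 0 := by
    have h1 : HasDerivAt (fun t : ℝ => w + t * δ) δ 0 := by
      simpa using ((hasDerivAt_id (0 : ℝ)).mul_const δ).const_add w
    have h2 : HasDerivAt (fun t : ℝ => (w + t * δ) ^ α) (δ * α * (w + 0 * δ) ^ (α - 1)) 0 :=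
      h1.rpow_const (Or.inr hα)
    have h3 := ((hasDerivAt_id (0 : ℝ)).mul_const a).add ((h2.sub_const (w ^ α)).const_mul lam)
    refine h3.congr_deriv ?_
    rw [zero_mul, add_zero]
    ring
  have ht := hd.tendsto_slope_zero_right
  refine ge_of_tendsto ht ?_
  filter_upwards [Ioo_mem_nhdsGT (zero_lt_one' ℝ)] with t ht
  have := h t ht.1 ht.2
  simp only [zero_add, zero_mul, add_zero, sub_self, mul_zero, sub_zero, smul_eq_mul]
  exact mul_nonneg (inv_nonneg.2 ht.1.le) this

end Penalty

/-! ### Primal optimality and the potential -/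

section Potential

open BoundedContinuousFunction

variable {X : Type*} [MetricSpace X] [CompactSpace X] [MeasurableSpace X] [BorelSpace X]

/-- A minimizer of `D + lam * W₁ ^ α` also minimizes the linearized objective `D + c * W₁`, where
`c` is the derivative of `lam * w ^ α` at the minimizer. -/
theorem linearized_objective_le (x₀ : X) {μ ξ : ProbabilityMeasure X} {lam α : ℝ}
    (hlam : 0 < lam) (hα : 1 ≤ α) {F : ProbabilityMeasure X → ℝ≥0∞}
    (hconv : ∀ ξ₁ ξ₂ : ProbabilityMeasure X, ∀ t : ℝ, ∀ (h0 : 0 ≤ t) (h1 : t ≤ 1),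
      F (mix ξ₁ ξ₂ t h0 h1) ≤ ENNReal.ofReal t * F ξ₁ + ENNReal.ofReal (1 - t) * F ξ₂)
    (hξ : F ξ ≠ ⊤)
    (hmin : ∀ η, F η ≠ ⊤ → (F ξ).toReal + lam * W1 μ ξ ^ α ≤ (F η).toReal + lam * W1 μ η ^ α)
    {η : ProbabilityMeasure X} (hη : F η ≠ ⊤) :
    (F ξ).toReal + α * lam * W1 μ ξ ^ (α - 1) * W1 μ ξ ≤
      (F η).toReal + α * lam * W1 μ ξ ^ (α - 1) * W1 μ η := by
  -- Compare `ξ` with the mixture of weight `t` on `η`; convexity of `F` and `W1 μ` bounds the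
  -- change of the objective.
  have key := add_slope_mul_nonneg (lam := lam) (w := W1 μ ξ) (δ := W1 μ η - W1 μ ξ)
    (a := (F η).toReal - (F ξ).toReal) hα fun t h0 h1 => by
      have hF := hconv η ξ t h0.le h1.le
      have hne : ENNReal.ofReal t * F η + ENNReal.ofReal (1 - t) * F ξ ≠ ⊤ :=
        ENNReal.add_ne_top.2 ⟨ENNReal.mul_ne_top ENNReal.ofReal_ne_top hη,
          ENNReal.mul_ne_top ENNReal.ofReal_ne_top hξ⟩
      have hF' := ENNReal.toReal_mono hne hF
      rw [ENNReal.toReal_add (ENNReal.mul_ne_top ENNReal.ofReal_ne_top hη)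
        (ENNReal.mul_ne_top ENNReal.ofReal_ne_top hξ), ENNReal.toReal_mul, ENNReal.toReal_mul,
        ENNReal.toReal_ofReal h0.le, ENNReal.toReal_ofReal (by linarith)] at hF'
      have hW := W1_mix_le x₀ μ η ξ h0.le h1.le
      have hW' : W1 μ (mix η ξ t h0.le h1.le) ^ α ≤ (W1 μ ξ + t * (W1 μ η - W1 μ ξ)) ^ α :=
        Real.rpow_le_rpow (W1_nonneg _ _) (by linarith) (by linarith)
      have hm := hmin _ (ne_top_of_le_ne_top hne hF)
      have := mul_le_mul_of_nonneg_left hW' hlam.le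
      linarith
  linarith

/-- A subgradient of `D` at a minimizer of `D + c * W₁(μ, ·)` that is `c`-Lipschitz. -/
theorem exists_mem_lipBall_forall_le (x₀ : X) {μ ξ : ProbabilityMeasure X} {c : ℝ} (hc : 0 ≤ c)
    {F : ProbabilityMeasure X → ℝ≥0∞}
    (hconv : ∀ ξ₁ ξ₂ : ProbabilityMeasure X, ∀ t : ℝ, ∀ (h0 : 0 ≤ t) (h1 : t ≤ 1),
      F (mix ξ₁ ξ₂ t h0 h1) ≤ ENNReal.ofReal t * F ξ₁ + ENNReal.ofReal (1 - t) * F ξ₂)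
    (hmin : ∀ η, F η ≠ ⊤ → (F ξ).toReal + c * W1 μ ξ ≤ (F η).toReal + c * W1 μ η) :
    ∃ f ∈ lipBall x₀ c, ∀ η, F η ≠ ⊤ → (F ξ).toReal + c * W1 μ ξ ≤
      (F η).toReal + (∫ x, f x ∂(μ : Measure X) - ∫ x, f x ∂(η : Measure X)) := by
  have hcont : ∀ η : ProbabilityMeasure X, Continuous fun f : X →ᵇ ℝ =>
      (F η).toReal + (∫ x, f x ∂(μ : Measure X) - ∫ x, f x ∂(η : Measure X)) := fun η =>
    continuous_const.add ((continuous_integral_boundedContinuousFunction _).sub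
      (continuous_integral_boundedContinuousFunction _))
  have hlin : ∀ (η : ProbabilityMeasure X) (a b : ℝ) (f g : X →ᵇ ℝ),
      ∫ x, (a • f + b • g) x ∂(η : Measure X) =
        a * ∫ x, f x ∂(η : Measure X) + b * ∫ x, g x ∂(η : Measure X) := by
    intro η a b f g
    simp only [BoundedContinuousFunction.coe_add, BoundedContinuousFunction.coe_smul,
      Pi.add_apply, smul_eq_mul]
    rw [integral_add ((integrable_of_continuous f.continuous _).const_mul a)
      ((integrable_of_continuous g.continuous _).const_mul b), integral_const_mul,
      integral_const_mul]
  obtain ⟨f, hf, h⟩ := exists_forall_le_of_concaveOn (ι := {η : ProbabilityMeasure X // F η ≠ ⊤})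
    (G := fun η f => (F η).toReal +
      (∫ x, f x ∂(μ : Measure X) - ∫ x, f x ∂((η : ProbabilityMeasure X) : Measure X)))
    (isCompact_lipBall x₀ hc) (convex_lipBall x₀ c) ⟨0, zero_mem_lipBall x₀ hc⟩
    (fun η => ⟨convex_lipBall x₀ c, fun f _ g _ a b _ _ hab => by
      simp only [hlin, smul_eq_mul]
      refine le_of_eq ?_
      have : b = 1 - a := by linarith
      subst this
      ring⟩)
    (fun η => (hcont η).continuousOn)
    (fun η₁ η₂ t h0 h1 => by
      have hF := hconv η₁ η₂ t h0 h1
      have h2 := ENNReal.mul_ne_top (ENNReal.ofReal_ne_top (r := t)) η₁.2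
      have h3 := ENNReal.mul_ne_top (ENNReal.ofReal_ne_top (r := 1 - t)) η₂.2
      refine ⟨⟨mix η₁ η₂ t h0 h1, ne_top_of_le_ne_top (ENNReal.add_ne_top.2 ⟨h2, h3⟩) hF⟩,
        fun f _ => ?_⟩
      have hF' := ENNReal.toReal_mono (ENNReal.add_ne_top.2 ⟨h2, h3⟩) hF
      rw [ENNReal.toReal_add h2 h3, ENNReal.toReal_mul, ENNReal.toReal_mul,
        ENNReal.toReal_ofReal h0, ENNReal.toReal_ofReal (by linarith)] at hF'
      simp only [integral_mix f.continuous]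
      linarith)
    (m := (F ξ).toReal + c * W1 μ ξ)
    -- For a single `η`, `c` times an optimal Kantorovich function recovers `c * W1 μ η`, so the
    -- level is `hmin`.
    (fun η => by
      obtain ⟨k, hk, hkW⟩ := exists_mem_lipBall_W1_eq x₀ μ (η : ProbabilityMeasure X)
      refine ⟨c • k, ⟨by simp [hk.1], fun x y => ?_⟩, ?_⟩
      · simp only [BoundedContinuousFunction.coe_smul, smul_eq_mul]
        rw [← mul_sub, abs_mul, abs_of_nonneg hc]
        have := hk.2 x y
        rw [one_mul] at this
        gcongr
      · refine (hmin η η.2).trans_eq ?_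
        simp only [BoundedContinuousFunction.coe_smul, smul_eq_mul, integral_const_mul]
        rw [← mul_sub, ← hkW])
  exact ⟨f, hf, fun η hη => h ⟨η, hη⟩⟩

end Potential

/-! ### Dual optimality -/

section Dual

variable {X : Type*} [MetricSpace X] [CompactSpace X] [MeasurableSpace X] [BorelSpace X]

/-- Weak duality, at a measure with finite divergence. -/
theorem dualObjective_le (x₀ : X) {φ : ℝ → EReal} {lam α : ℝ} (hlam : 0 < lam) (hα : 1 ≤ α)
    {μ ν ξ : ProbabilityMeasure X} {d : ℝ} (hd : divergence φ ξ ν = (d : EReal)) {g : X → ℝ}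
    (hg : g ∈ dualFeasible lam α x₀) :
    dualObjective φ lam α μ ν g ≤ ((d + lam * W1 μ ξ ^ α : ℝ) : EReal) := by
  obtain ⟨⟨hglip, -⟩, hg1⟩ := hg
  have hW := integral_sub_le_mul_W1 μ ξ (lipNorm_nonneg g) (abs_sub_le_lipNorm_mul hglip)
  have hW0 := W1_nonneg μ ξ
  have hle : ((∫ x, g x ∂(μ : Measure X) : ℝ) : EReal) - tightConjugate φ ν g ≤
      ((d + lipNorm g * W1 μ ξ : ℝ) : EReal) := by
    have h1 : ((∫ x, g x ∂(ξ : Measure X) - d : ℝ) : EReal) ≤ tightConjugate φ ν g := by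
      rw [EReal.coe_sub, ← hd]
      exact le_iSup (fun η : ProbabilityMeasure X =>
        ((∫ x, g x ∂(η : Measure X) : ℝ) : EReal) - divergence φ η ν) ξ
    refine (EReal.sub_le_sub le_rfl h1).trans ?_
    rw [← EReal.coe_sub, EReal.coe_le_coe_iff]
    linarith
  unfold dualObjective
  split_ifs with h
  · refine hle.trans (EReal.coe_le_coe_iff.2 ?_)
    rw [h, Real.rpow_one]
    linarith [mul_le_mul_of_nonneg_right (hg1 h) hW0]
  · have hα1 : 1 < α := lt_of_le_of_ne hα (Ne.symm h)
    refine (EReal.sub_le_sub hle le_rfl).trans ?_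
    rw [← EReal.coe_sub, EReal.coe_le_coe_iff]
    have := mul_le_add_penalty hlam hα1 (lipNorm_nonneg g) hW0
    rw [penalty] at this
    linarith

end Dual

end

end MoreauYosida

theorem proposition5 {X : Type*} [MetricSpace X] [CompactSpace X] [MeasurableSpace X]
    [BorelSpace X] (x₀ : X) (φ : ℝ → EReal) (hφ : MoreauYosida.IsDivergenceFunction φ)
    (lam α : ℝ) (hlam : 0 < lam) (hα : 1 ≤ α)
    (μ ν ξ : ProbabilityMeasure X)
    (hξ : MoreauYosida.moreauYosida φ lam α μ ν =
      MoreauYosida.primalObjective φ lam α μ ν ξ) :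
    ∃ f : X → ℝ,
      -- `f` is admissible in the dual problem and attains its maximum,
      -- which is the value of the Moreau–Yosida approximation
      f ∈ MoreauYosida.dualFeasible lam α x₀ ∧
      IsMaxOn (MoreauYosida.dualObjective φ lam α μ ν)
        (MoreauYosida.dualFeasible lam α x₀) f ∧
      MoreauYosida.dualObjective φ lam α μ ν f = MoreauYosida.moreauYosida φ lam α μ ν ∧
      MoreauYosida.IsCsiszarPotential φ ξ ν f ∧
      (∃ k : X → ℝ, MoreauYosida.IsKantorovichPotential μ ξ k ∧
        f = fun x => α * lam * MoreauYosida.W1 μ ξ ^ (α - 1) * k x) ∧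
      ((1 < α ∨ μ ≠ ξ) →
        MoreauYosida.lipNorm f = α * lam * MoreauYosida.W1 μ ξ ^ (α - 1)) := by
  open MoreauYosida in
  obtain ⟨s, hs⟩ := hφ.exists_subgradient
  set F : ProbabilityMeasure X → ℝ≥0∞ := excessDivergence φ s ν
  have hF : ∀ η, divergence φ η ν = (F η : EReal) := hφ.divergence_eq hs ν
  have hconv : ∀ ξ₁ ξ₂ : ProbabilityMeasure X, ∀ t : ℝ, ∀ (h0 : 0 ≤ t) (h1 : t ≤ 1),
      F (mix ξ₁ ξ₂ t h0 h1) ≤ ENNReal.ofReal t * F ξ₁ + ENNReal.ofReal (1 - t) * F ξ₂ :=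
    fun ξ₁ ξ₂ t h0 h1 => hφ.excessDivergence_mix_le s ν ξ₁ ξ₂ h0 h1
  have hobj : ∀ η, F η ≠ ⊤ → primalObjective φ lam α μ ν η =
      (((F η).toReal + lam * W1 μ η ^ α : ℝ) : EReal) := fun η hη => by
    rw [primalObjective, hF, ← EReal.coe_ennreal_toReal hη, EReal.coe_add]
  have hle : ∀ η, primalObjective φ lam α μ ν ξ ≤ primalObjective φ lam α μ ν η :=
    fun η => hξ ▸ iInf_le _ η
  -- `ν` is a competitor of finite objective, so the minimizer has finite divergence.
  have hFν : F ν ≠ ⊤ := by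
    have h := hφ.divergence_self ν
    rw [hF] at h
    intro h'
    simp [h'] at h
  have hFξ : F ξ ≠ ⊤ := by
    intro h
    have h1 := hle ν
    rw [hobj ν hFν, primalObjective, hF, h, EReal.coe_ennreal_top, EReal.top_add_coe] at h1
    exact absurd h1 (not_le.2 (EReal.coe_lt_top _))
  have hmin : ∀ η, F η ≠ ⊤ →
      (F ξ).toReal + lam * W1 μ ξ ^ α ≤ (F η).toReal + lam * W1 μ η ^ α := fun η hη => by
    have := hle η
    rwa [hobj η hη, hobj ξ hFξ, EReal.coe_le_coe_iff] at this
  have hd : divergence φ ξ ν = ((F ξ).toReal : EReal) := by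
    rw [hF, EReal.coe_ennreal_toReal hFξ]
  have hW0 := W1_nonneg μ ξ
  have hlin := fun η (hη : F η ≠ ⊤) =>
    linearized_objective_le x₀ (μ := μ) hlam hα hconv hFξ hmin hη
  have hslope := slope_mul_self (lam := lam) hα hW0
  set c : ℝ := α * lam * W1 μ ξ ^ (α - 1) with hcdef
  have hc : 0 ≤ c := by positivity
  obtain ⟨f, ⟨hf0, hf⟩, hfle⟩ := exists_mem_lipBall_forall_le x₀ hc hconv hlin
  have hfip : ∫ x, f x ∂(μ : Measure X) - ∫ x, f x ∂(ξ : Measure X) = c * W1 μ ξ :=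
    le_antisymm (integral_sub_le_mul_W1 μ ξ hc hf) (by linarith [hfle ξ hFξ])
  have hflip : IsLip f := isLip_of_forall_abs_le hf
  have hconj := tightConjugate_eq hF hFξ (f := f) fun η hη => by linarith [hfle η hη]
  have hnorm_le : lipNorm f ≤ c := lipNorm_le hc hf
  have hnorm : 1 < α ∨ μ ≠ ξ → lipNorm f = c := by
    intro h
    refine le_antisymm hnorm_le ?_
    -- If `W1 μ ξ = 0` then `μ = ξ`, so `1 < α` and `c = 0`. Otherwise `c * W1 μ ξ ≤ lipNorm f * W1
    -- μ ξ` can be divided by the distance.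
    rcases hW0.eq_or_lt with hW | hW
    · have hα1 : 1 < α := h.resolve_right (not_not.2 (eq_of_W1_eq_zero hW.symm))
      have : c = 0 := by
        rw [hcdef, ← hW, Real.zero_rpow (by linarith), mul_zero]
      rw [this]
      exact lipNorm_nonneg f
    · have h1 := integral_sub_le_mul_W1 μ ξ (lipNorm_nonneg f) (abs_sub_le_lipNorm_mul hflip)
      rw [hfip] at h1
      exact le_of_mul_le_mul_right h1 hW
  have hfeas : (f : X → ℝ) ∈ dualFeasible lam α x₀ :=
    ⟨⟨hflip, hf0⟩, fun h => by simpa [hcdef, h] using hnorm_le⟩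
  have hval : dualObjective φ lam α μ ν f =
      (((F ξ).toReal + lam * W1 μ ξ ^ α : ℝ) : EReal) := by
    unfold dualObjective
    rw [hconj]
    split_ifs with h
    · rw [← EReal.coe_sub, EReal.coe_eq_coe_iff]
      rw [hslope] at hfip
      rw [h] at hfip ⊢
      linarith
    · have hα1 : 1 < α := lt_of_le_of_ne hα (Ne.symm h)
      have hpen := penalty_slope hlam hα1 hW0
      rw [← hcdef, penalty] at hpen
      rw [← EReal.coe_sub, ← EReal.coe_sub, EReal.coe_eq_coe_iff, hnorm (Or.inl hα1), hpen]
      rw [hslope] at hfip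
      linarith
  refine ⟨f, hfeas, fun g hg => ?_, ?_, ⟨hflip, ?_⟩, ?_, hnorm⟩
  · show dualObjective φ lam α μ ν g ≤ dualObjective φ lam α μ ν f
    rw [hval]
    exact dualObjective_le x₀ hlam hα hd hg
  · rw [hval, hξ, hobj ξ hFξ]
  · rw [hconj, hd, ← EReal.coe_sub, sub_sub_cancel]
  -- For `c = 0` the function `f` vanishes identically and any Kantorovich potential will do;
  -- otherwise divide `f` by `c`.
  · rcases hc.eq_or_lt with hc0 | hcpos
    · obtain ⟨k, hk, hkW⟩ := exists_mem_lipBall_W1_eq x₀ μ ξ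
      refine ⟨k, ⟨isLip_of_forall_abs_le hk.2, lipNorm_le zero_le_one hk.2, hkW⟩, ?_⟩
      funext x
      have h := hf x x₀
      rw [hf0, sub_zero, ← hc0, zero_mul] at h
      rw [← hc0, zero_mul]
      exact abs_eq_zero.1 (le_antisymm h (abs_nonneg _))
    · have hk : ∀ x y, |c⁻¹ * f x - c⁻¹ * f y| ≤ 1 * dist x y := fun x y => by
        rw [← mul_sub, abs_mul, abs_of_pos (inv_pos.2 hcpos), one_mul, inv_mul_le_iff₀ hcpos]
        exact hf x y
      refine ⟨fun x => c⁻¹ * f x, ⟨isLip_of_forall_abs_le hk, lipNorm_le zero_le_one hk, ?_⟩, ?_⟩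
      · rw [integral_const_mul, integral_const_mul, ← mul_sub, hfip,
          inv_mul_cancel_left₀ hcpos.ne']
      · funext x
        rw [mul_inv_cancel_left₀ hcpos.ne']
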